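/- Let $k$ be an algebraically closed field of characteristic zero, and let $K=k(t)$ be the rational function field over $k$. The places of $K$ are the valuations $v_\alpha$ ($\alpha\in k$) attached to $t-\alpha$ and the valuation $v_\infty$ attached to $1/t$. For $\phi\in K(z)$, viewed as an endomorphism of $\mathbb{P}^1$ over $K$, and $A\in\mathrm{PGL}_2(K)$, put $\phi^A=A\circ\phi\circ A^{-1}$. Call $\phi$ isotrivial over $K$ if $\phi^A$ is defined over $k$ for some $A\in\mathrm{PGL}_2(K)$. Say that $\phi$, of degree $d$, has simple good reduction at a place $\mathfrak{p}$ if $\phi=f/g$ for polynomials $f,g$ of degree at most $d$ whose coefficients are $\mathfrak{p}$-integral and not all of positive $\mathfrak{p}$-valuation, and such that the resultant of the degree-$d$ homogenizations of $f$ and $g$ is a $\mathfrak{p}$-unit; say that $\phi$ has good reduction at $\mathfrak{p}$ if $\phi^A$ has simple good reduction at $\mathfrak{p}$ for some $A\in\mathrm{PGL}_2(K)$ (which may depend on $\mathfrak{p}$). **Theorem 1.2.** Let $S$ be a finite set of places of $K$ of cardinality $s\ge 1$. Let $\phi\in K(z)$ be of degree $d$, not isotrivial over $K$, with good reduction at every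 place outside $S$. Let $P\in\mathbb{P}^1(K)$ be a periodic point of $\phi$ with minimal period $n$. Then $$n\le \prod_{\substack{p\le b(d,s)\\ p\ \text{prime}}}\max\left\{b(d,s),\ p\cdot 3^{2s-1}\right\},\qquad\text{where } b(d,s)=\frac{9^{s-1}+1}{2}(2d+1)+2.$$ -/

import Mathlib

open Polynomial

noncomputable section

namespace RatDyn

section AnyField

variable {F : Type*} [Field F]

/-- The degree of a rational function, i.e. of the corresponding endomorphism of the projective
line: the maximum of the degrees of numerator and denominator in lowest terms. -/
def ratDegree (φ : RatFunc F) : ℕ :=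
  max φ.num.natDegree φ.denom.natDegree

open Classical in
/-- The map induced by a rational function `φ` on the `F`-rational points `F ∪ {∞}` of the
projective line. With `φ = f / g` in lowest terms and `d` its degree, `x` goes to `f(x) / g(x)`
(to `∞` if `g(x) = 0`), and `∞ = [1 : 0]` goes to `[f_d : g_d]`, where `f_d`, `g_d` are the
coefficients of `f` and `g` in degree `d`. -/
def toMap (φ : RatFunc F) : OnePoint F → OnePoint F
  | none =>
      if φ.denom.coeff (ratDegree φ) = 0 then none
      else some (φ.num.coeff (ratDegree φ) / φ.denom.coeff (ratDegree φ))
  | some x =>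
      if φ.denom.eval x = 0 then none
      else some (φ.num.eval x / φ.denom.eval x)

/-- The composite `A ∘ ψ` of a rational function with the automorphism
`z ↦ (a z + b) / (c z + d)` of the projective line given by the invertible matrix
`A = (a b; c d)`. (The denominator below vanishes only if `ψ` is the constant sent to `∞`
by `A`; the value is then `0`.) -/
def postcomp (A : GL (Fin 2) F) (ψ : RatFunc F) : RatFunc F :=
  (RatFunc.C (A 0 0) * ψ + RatFunc.C (A 0 1)) / (RatFunc.C (A 1 0) * ψ + RatFunc.C (A 1 1))

/-- The conjugate `A ∘ φ ∘ A⁻¹`. Here `postcomp A⁻¹ RatFunc.X` is the rational function giving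
the automorphism `A⁻¹`, and it is substituted for the variable of `φ`. -/
def conj (A : GL (Fin 2) F) (φ : RatFunc F) : RatFunc F :=
  postcomp A (RatFunc.eval (RatFunc.C : F →+* RatFunc F) (postcomp A⁻¹ RatFunc.X) φ)

end AnyField

variable {k : Type*} [Field k]

/-- The rational function `φ ∈ k(t)(z)` is defined over the constant field `k`. -/
def IsDefinedOverConstants (φ : RatFunc (RatFunc k)) : Prop :=
  ∃ f g : k[X], g ≠ 0 ∧
    φ = algebraMap (RatFunc k)[X] (RatFunc (RatFunc k)) (f.map RatFunc.C) /
      algebraMap (RatFunc k)[X] (RatFunc (RatFunc k)) (g.map RatFunc.C)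

/-- `φ` is isotrivial over `K = k(t)`: some conjugate of it by an element of `PGL₂(K)` is defined
over `k`. -/
def IsIsotrivial (φ : RatFunc (RatFunc k)) : Prop :=
  ∃ A : GL (Fin 2) (RatFunc k), IsDefinedOverConstants (conj A φ)

/-- The prime of `k[t]` generated by `t - α`. -/
def pointPrime (α : k) : IsDedekindDomain.HeightOneSpectrum k[X] where
  asIdeal := Ideal.span {X - C α}
  isPrime := (Ideal.span_singleton_prime (X_sub_C_ne_zero α)).2 (prime_X_sub_C α)
  ne_bot := by
    rw [Ne, Ideal.span_singleton_eq_bot]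
    exact X_sub_C_ne_zero α

open Classical in
/-- The places of `k(t)`, for `k` algebraically closed, are the points of `k ∪ {∞}`: the place
`α` is the valuation of the polynomial `t - α`, the place `∞` that of `1 / t`. The valuations are
written multiplicatively, so that `placeVal 𝔭 x ≤ 1` means `v_𝔭(x) ≥ 0`. -/
def placeVal : OnePoint k → Valuation (RatFunc k) (WithZero (Multiplicative ℤ))
  | none => RatFunc.inftyValuation k
  | some α => (pointPrime α).valuation (RatFunc k)

/-- Simple good reduction at the place `𝔭`: `φ` is a quotient `f / g` of polynomials of degree at
most `d = deg φ` whose coefficients are `𝔭`-integral and not all of positive valuation, such that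
the resultant of `f` and `g`, homogenized in degree `d`, is a `𝔭`-unit. -/
def HasSimpleGoodReduction (φ : RatFunc (RatFunc k)) (𝔭 : OnePoint k) : Prop :=
  ∃ f g : (RatFunc k)[X],
    g ≠ 0 ∧ f.natDegree ≤ ratDegree φ ∧ g.natDegree ≤ ratDegree φ ∧
    φ = algebraMap (RatFunc k)[X] (RatFunc (RatFunc k)) f /
      algebraMap (RatFunc k)[X] (RatFunc (RatFunc k)) g ∧
    (∀ i, placeVal 𝔭 (f.coeff i) ≤ 1 ∧ placeVal 𝔭 (g.coeff i) ≤ 1) ∧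
    (∃ i, placeVal 𝔭 (f.coeff i) = 1 ∨ placeVal 𝔭 (g.coeff i) = 1) ∧
    placeVal 𝔭 (resultant f g (ratDegree φ) (ratDegree φ)) = 1

/-- Good reduction at the place `𝔭`: some conjugate by an element of `PGL₂(k(t))` has simple good
reduction at `𝔭`. -/
def HasGoodReduction (φ : RatFunc (RatFunc k)) (𝔭 : OnePoint k) : Prop :=
  ∃ A : GL (Fin 2) (RatFunc k), HasSimpleGoodReduction (conj A φ) 𝔭

/-- `b(d, s) = ((9 ^ (s - 1) + 1) / 2) (2 d + 1) + 2`, for `s ≥ 1`. The division is exact, as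
`9 ^ (s - 1)` is odd. -/
def primeBound (d s : ℕ) : ℕ :=
  (9 ^ (s - 1) + 1) / 2 * (2 * d + 1) + 2

/-- `C(d, s)`, for `s ≥ 1`: the product over the primes `p ≤ b(d, s)` of
`max {b(d, s), p · 3 ^ (2 s - 1)}`. -/
def periodBound (d s : ℕ) : ℕ :=
  ∏ p ∈ (Finset.range (primeBound d s + 1)).filter Nat.Prime,
    max (primeBound d s) (p * 3 ^ (2 * s - 1))

end RatDyn

end

open Polynomial

noncomputable section

namespace RatDyn

section Sieve

/-! ### A sieve -/

/-! Represent the cycle by vectors `p i` and use the coordinate sending `p 0`, `p 1`, `p 2` to 0, 1,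
∞. At a place of good reduction the map does not increase distances between normalized points. Going
once round the cycle, it must preserve them. The ultrametric inequality and Bézout then show that
the distance from `p i` to `p (i + l)` depends only on gcd(l, n), up to weights of the points that
cancel in cross-ratios. Let l run through the residues for which l, ..., l + 3 have the same gcds
with n as 1, ..., 4, and let z be the coordinate of `p (l + 2)`, or of `p (l + 3)`. Outside S, the
valuations of z and of 1 - z do not depend on l. If there are J such residues, the Chinese remainder
theorem gives n ≤ 360 J² (`le_card_goodResidues_sq`), so it remains to bound J. Nonconstant z: these
are coprime polynomial solutions of F + G = L with prescribed multiplicities outside S.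
Mason–Stothers bounds their heights, and the nonzero determinant of two distinct solutions keeps
their multiplicity vectors on S ∪ {∞} apart. Packing leaves at most 6 · 384^s of them when s ≥ 2
(`card_le_of_placeVal_eq`). When s = 1 and J > 1 there are none, since ratios of such z are units at
all places but one. Constant z: if l + 2 and l + 3 both have constant coordinates, the conjugated
map sends one constant to another. More than 2d such points would force it to be defined over k
(`isIsotrivial_of_card_lt`), against non-isotriviality. So J ≤ 2 · 6 · 384^s + 2d - 1 for s ≥ 2 and
J ≤ 2d - 1 for s = 1. A few small primes in the product defining the bound already exceed 360 J².
Periods below 5 are trivial. -/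

open Classical in
/-- The residues `l` modulo `n` such that `l, l + 1, l + 2, l + 3` have the same greatest common
divisors with `n` as `1, 2, 3, 4`. -/
def goodResidues (n : ℕ) : Finset ℕ :=
  (Finset.range n).filter fun l ↦ ∀ j < 4, Nat.gcd (l + j) n = Nat.gcd (1 + j) n

theorem mem_goodResidues {n l : ℕ} :
    l ∈ goodResidues n ↔ l < n ∧ ∀ j < 4, Nat.gcd (l + j) n = Nat.gcd (1 + j) n := by
  simp [goodResidues]

theorem one_le_card_goodResidues {n : ℕ} (hn : 0 < n) : 1 ≤ (goodResidues n).card := by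
  rw [Nat.one_le_iff_ne_zero, Finset.card_ne_zero]
  rcases Nat.lt_or_ge 1 n with h | h
  · exact ⟨1, mem_goodResidues.2 ⟨h, fun _ _ ↦ rfl⟩⟩
  · obtain rfl : n = 1 := by omega
    exact ⟨0, mem_goodResidues.2 ⟨one_pos, by simp⟩⟩

/-- The gcd with a product of coprime moduli is the product of the gcds, so good residues glue by
the Chinese remainder theorem. -/
theorem card_goodResidues_mul {m n : ℕ} (h : Nat.Coprime m n) (hm : 0 < m) (hn : 0 < n) :
    (goodResidues m).card * (goodResidues n).card ≤ (goodResidues (m * n)).card := by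
  rw [← Finset.card_product]
  refine Finset.card_le_card_of_injOn (fun x ↦ (Nat.chineseRemainder h x.1 x.2 : ℕ)) ?_ ?_
  · rintro ⟨a, b⟩ hab
    simp only [Finset.coe_product, Set.mem_prod, Finset.mem_coe, mem_goodResidues] at hab ⊢
    refine ⟨Nat.chineseRemainder_lt_mul h a b hm.ne' hn.ne', fun j hj ↦ ?_⟩
    have h1 := (Nat.chineseRemainder h a b).2
    rw [h.gcd_mul, h.gcd_mul, (h1.1.add_right j).gcd_eq, (h1.2.add_right j).gcd_eq,
      hab.1.2 j hj, hab.2.2 j hj]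
  · rintro ⟨a, b⟩ hab ⟨a', b'⟩ hab' he
    simp only [Finset.coe_product, Set.mem_prod, Finset.mem_coe, mem_goodResidues] at hab hab'
    have h1 := (Nat.chineseRemainder h a b).2
    have h2 := (Nat.chineseRemainder h a' b').2
    simp only at he
    rw [he] at h1
    have e1 := (h1.1.symm.trans h2.1).eq_of_lt_of_lt hab.1.1 hab'.1.1
    have e2 := (h1.2.symm.trans h2.2).eq_of_lt_of_lt hab.2.1 hab'.2.1
    rw [e1, e2]

theorem gcd_pow_eq_gcd_pow {p e r x : ℕ} (hp : p.Prime) (her : e ≤ r) (hx : ¬ p ^ e ∣ x) :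
    Nat.gcd x (p ^ r) = Nat.gcd x (p ^ e) := by
  apply Nat.dvd_antisymm
  · refine Nat.dvd_gcd (Nat.gcd_dvd_left _ _) ?_
    obtain ⟨a, -, ha⟩ := (Nat.dvd_prime_pow hp).1 (Nat.gcd_dvd_right x (p ^ r))
    rw [ha]
    refine pow_dvd_pow _ (le_of_not_ge fun hea ↦ hx ?_)
    exact (pow_dvd_pow p hea).trans (ha ▸ Nat.gcd_dvd_left _ _)
  · exact Nat.gcd_dvd_gcd_of_dvd_right _ (pow_dvd_pow _ her)

/-- When p^e does not divide a number, its gcd with any higher power of p is already determined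
modulo p^e. Hence all p^t lifts of an element of R are good. -/
theorem card_goodResidues_prime_pow {p e t : ℕ} (hp : p.Prime) (R : Finset ℕ)
    (hR : ∀ l ∈ R, l < p ^ e ∧ ∀ j < 4, ¬ p ^ e ∣ l + j ∧ ¬ p ^ e ∣ 1 + j ∧
      Nat.gcd (l + j) (p ^ e) = Nat.gcd (1 + j) (p ^ e)) :
    R.card * p ^ t ≤ (goodResidues (p ^ (e + t))).card := by
  rw [← Finset.card_range (p ^ t), ← Finset.card_product]
  refine Finset.card_le_card_of_injOn (fun x ↦ x.1 + p ^ e * x.2) ?_ ?_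
  · rintro ⟨l, q⟩ h
    simp only [Finset.coe_product, Set.mem_prod, Finset.mem_coe, mem_goodResidues,
      Finset.mem_range] at h ⊢
    obtain ⟨h1, h2⟩ := hR l h.1
    refine ⟨?_, fun j hj ↦ ?_⟩
    · calc l + p ^ e * q < p ^ e + p ^ e * q := by omega
        _ = p ^ e * (q + 1) := by ring
        _ ≤ p ^ e * p ^ t := Nat.mul_le_mul_left _ h.2
        _ = _ := (pow_add _ _ _).symm
    · obtain ⟨h3, h4, h5⟩ := h2 j hj
      have h6 : l + p ^ e * q + j = l + j + p ^ e * q := by ring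
      rw [h6, gcd_pow_eq_gcd_pow hp (Nat.le_add_right e t) h4,
        gcd_pow_eq_gcd_pow hp (Nat.le_add_right e t), ← h5]
      · simp
      · rwa [Nat.dvd_add_left (dvd_mul_right _ _)]
  · rintro ⟨l, q⟩ h ⟨l', q'⟩ h' he
    simp only [Finset.coe_product, Set.mem_prod, Finset.mem_coe, Finset.mem_range] at h h' he
    have h1 := (hR l h.1).1
    have h2 := (hR l' h'.1).1
    have h3 : l = l' := by
      have := congrArg (· % p ^ e) he
      simpa [Nat.mod_eq_of_lt h1, Nat.mod_eq_of_lt h2] using this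
    subst h3
    have h4 : q = q' := Nat.eq_of_mul_eq_mul_left (by omega : 0 < p ^ e) (by omega)
    rw [h4]

/-- The constant is 360 = 8 · 9 · 5. For p = 2, 3 only the residue 1, modulo 8 or 9, is lifted. For
p ≥ 5 the residues 1, ..., p - 4 keep l, ..., l + 3 prime to p, and (p - 4)² ≥ p from p = 7 on, so
only p = 5 costs a factor. -/
theorem pow_le_gcd_mul_card_goodResidues_sq {p r : ℕ} (hp : p.Prime) (hr : 0 < r) :
    p ^ r ≤ Nat.gcd 360 (p ^ r) * (goodResidues (p ^ r)).card ^ 2 := by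
  have hone := one_le_card_goodResidues (pow_pos hp.pos r)
  have hdvd : p ^ r ∣ 360 → p ^ r ≤ Nat.gcd 360 (p ^ r) * (goodResidues (p ^ r)).card ^ 2 := by
    intro h
    rw [Nat.gcd_eq_right h]
    exact Nat.le_mul_of_pos_right _ (by positivity)
  -- Lifting multiplies both the modulus and the count by p^t, and the count enters squared, so the
  -- inequality at level e propagates upwards.
  have hpow : ∀ {e t c : ℕ}, r = e + t → 1 ≤ e → c * p ^ t ≤ (goodResidues (p ^ r)).card →
      p ^ e ≤ Nat.gcd 360 (p ^ e) * c ^ 2 →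
      p ^ r ≤ Nat.gcd 360 (p ^ r) * (goodResidues (p ^ r)).card ^ 2 := by
    intro e t c hret he hc hle
    calc p ^ r = p ^ e * p ^ t := by rw [hret, pow_add]
      _ ≤ (Nat.gcd 360 (p ^ e) * c ^ 2) * (p ^ t) ^ 2 :=
        Nat.mul_le_mul hle (Nat.le_self_pow two_ne_zero _)
      _ = Nat.gcd 360 (p ^ e) * (c * p ^ t) ^ 2 := by ring
      _ ≤ _ := Nat.mul_le_mul (Nat.le_of_dvd (Nat.gcd_pos_of_pos_left _ (by norm_num))
          (Nat.gcd_dvd_gcd_of_dvd_right _ (pow_dvd_pow p (by omega)))) (Nat.pow_le_pow_left hc 2)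
  rcases Nat.lt_or_ge p 5 with h5 | h5
  · have h23 : p = 2 ∨ p = 3 := by
      have := hp.two_le
      interval_cases p
      · simp
      · simp
      · norm_num at hp
    rcases h23 with rfl | rfl
    · rcases Nat.lt_or_ge r 3 with h | h
      · exact hdvd (by interval_cases r <;> norm_num)
      · obtain ⟨t, rfl⟩ := Nat.exists_eq_add_of_le h
        exact hpow rfl (by norm_num)
          (card_goodResidues_prime_pow (e := 3) (t := t) hp {1} (by decide)) (by decide)
    · rcases Nat.lt_or_ge r 2 with h | h
      · exact hdvd (by interval_cases r; norm_num)
      · obtain ⟨t, rfl⟩ := Nat.exists_eq_add_of_le h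
        exact hpow rfl (by norm_num)
          (card_goodResidues_prime_pow (e := 2) (t := t) hp {1} (by decide)) (by decide)
  · obtain ⟨t, rfl⟩ := Nat.exists_eq_add_of_le (Nat.succ_le_of_lt hr)
    have hlt : ∀ {a : ℕ}, 0 < a → a < p → ¬ p ^ 1 ∣ a ∧ Nat.gcd a (p ^ 1) = 1 := by
      intro a ha hap
      have : ¬ p ∣ a := Nat.not_dvd_of_pos_of_lt ha hap
      rw [pow_one]
      exact ⟨this, ((Nat.Prime.coprime_iff_not_dvd hp).2 this).symm⟩
    have key := card_goodResidues_prime_pow (e := 1) (t := t) hp (Finset.Icc 1 (p - 4)) (by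
      intro l hl
      rw [Finset.mem_Icc] at hl
      refine ⟨by rw [pow_one]; omega, fun j hj ↦ ?_⟩
      obtain ⟨h1, h2⟩ := hlt (a := l + j) (by omega) (by omega)
      obtain ⟨h3, h4⟩ := hlt (a := 1 + j) (by omega) (by omega)
      exact ⟨h1, h3, h2.trans h4.symm⟩)
    rw [Nat.card_Icc] at key
    refine hpow rfl le_rfl key ?_
    rcases h5.eq_or_lt with rfl | h6
    · decide
    · have h7 : 7 ≤ p := by
        rcases Nat.lt_or_ge p 7 with h | h
        · obtain rfl : p = 6 := by omega
          norm_num at hp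
        · exact h
      obtain ⟨q, rfl⟩ := Nat.exists_eq_add_of_le h7
      have h8 : 7 + q - 4 + 1 - 1 = q + 3 := by omega
      rw [h8, pow_one]
      calc 7 + q ≤ 1 * (q + 3) ^ 2 := by nlinarith
        _ ≤ _ := Nat.mul_le_mul_right _ (Nat.gcd_pos_of_pos_left _ (by norm_num))

theorem le_gcd_mul_card_goodResidues_sq {n : ℕ} (hn : 0 < n) :
    n ≤ Nat.gcd 360 n * (goodResidues n).card ^ 2 := by
  induction n using Nat.recOnPosPrimePosCoprime with
  | prime_pow p r hp hr => exact pow_le_gcd_mul_card_goodResidues_sq hp hr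
  | zero => omega
  | one =>
    have := Nat.one_le_pow 2 _ (one_le_card_goodResidues hn)
    simpa using this
  | coprime a b ha hb hab iha ihb =>
    have iha := iha (by omega)
    have ihb := ihb (by omega)
    calc a * b ≤ _ := Nat.mul_le_mul iha ihb
      _ = Nat.gcd 360 (a * b) * ((goodResidues a).card * (goodResidues b).card) ^ 2 := by
        rw [hab.gcd_mul]; ring
      _ ≤ _ := Nat.mul_le_mul_left _
        (Nat.pow_le_pow_left (card_goodResidues_mul hab (by omega) (by omega)) 2)

theorem le_card_goodResidues_sq {n : ℕ} (hn : 0 < n) :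
    n ≤ 360 * (goodResidues n).card ^ 2 :=
  (le_gcd_mul_card_goodResidues_sq hn).trans
    (Nat.mul_le_mul_right _ (Nat.le_of_dvd (by norm_num) (Nat.gcd_dvd_left _ _)))

/-! ### Lower bounds for the period bound -/

theorem prod_le_periodBound {d s : ℕ} (T : Finset ℕ) (f : ℕ → ℕ)
    (hT : ∀ p ∈ T, p.Prime ∧ p ≤ primeBound d s)
    (hf : ∀ p ∈ T, f p ≤ max (primeBound d s) (p * 3 ^ (2 * s - 1))) :
    ∏ p ∈ T, f p ≤ periodBound d s := by
  refine (Finset.prod_le_prod' hf).trans ?_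
  refine Finset.prod_le_prod_of_subset_of_one_le' (fun p hp ↦ ?_) (fun p _ _ ↦ ?_)
  · have := hT p hp
    simp only [Finset.mem_filter, Finset.mem_range]
    exact ⟨by omega, this.1⟩
  · refine le_max_of_le_left ?_
    simp [primeBound]

theorem le_periodBound_one {d : ℕ} : 360 * (2 * d - 1) ^ 2 ≤ periodBound d 1 := by
  have hb : primeBound d 1 = 2 * d + 3 := by simp [primeBound]
  rcases Nat.lt_or_ge d 4 with h | h
  · have h2 := prod_le_periodBound (d := d) (s := 1)
      ((Finset.range (2 * d + 4)).filter Nat.Prime) (fun p ↦ max (2 * d + 3) (p * 3))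
      (by rw [hb]; intro p hp; simp only [Finset.mem_filter, Finset.mem_range] at hp
          exact ⟨hp.2, by omega⟩) (by simp [hb])
    refine le_trans ?_ h2
    interval_cases d <;> decide
  -- Here 2 d + 3 ≥ 11. The factors at 2 and 3 supply (2 d + 3)², the others 15 · 21 · 33 > 360.
  · have h2 := prod_le_periodBound (d := d) (s := 1) {2, 3, 5, 7, 11}
      (fun p ↦ if p < 5 then 2 * d + 3 else p * 3)
      (by rw [hb]; intro p hp; simp only [Finset.mem_insert, Finset.mem_singleton] at hp
          rcases hp with rfl | rfl | rfl | rfl | rfl <;> exact ⟨by norm_num, by omega⟩)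
      (by rw [hb]; intro p hp; split_ifs <;> simp)
    refine le_trans ?_ h2
    simp
    have : (2 * d - 1) ^ 2 ≤ (2 * d + 3) ^ 2 := Nat.pow_le_pow_left (by omega) 2
    nlinarith

/-- With Q = 9^(s - 1), the left side is of order d² Q^6 because 384² < 9^6, while seven factors p ·
3 Q already give Q^7. -/
theorem le_periodBound {d s : ℕ} (hd : 1 ≤ d) (hs : 2 ≤ s) :
    360 * (2 * (6 * 384 ^ s) + (2 * d - 1)) ^ 2 ≤ periodBound d s := by
  obtain ⟨r, rfl⟩ := Nat.exists_eq_add_of_le hs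
  set Q := 9 ^ (r + 1) with hQ
  have hQ9 : 9 ≤ Q := by
    rw [hQ, pow_succ]; have := Nat.one_le_pow r 9 (by norm_num); omega
  have h3 : 3 ^ (2 * (2 + r) - 1) = 3 * Q := by
    rw [hQ, show 2 * (2 + r) - 1 = 2 * (r + 1) + 1 by omega, pow_succ, pow_mul]; norm_num
    ring
  have hodd : 2 * ((Q + 1) / 2) = Q + 1 := by
    have : Odd Q := by rw [hQ]; exact Odd.pow (by decide)
    obtain ⟨m, hm⟩ := this
    omega
  have hb : primeBound d (2 + r) = (Q + 1) / 2 * (2 * d + 1) + 2 := by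
    rw [primeBound, hQ, show 2 + r - 1 = r + 1 by omega]
  have hbQ : Q * d ≤ primeBound d (2 + r) ∧ 10 * d + 7 ≤ primeBound d (2 + r) := by
    rw [hb]; constructor <;> nlinarith
  have h384 : (384 ^ (2 + r)) ^ 2 ≤ 147456 * Q ^ 6 := by
    have h1 : (384 ^ (2 + r)) ^ 2 = 147456 * 147456 ^ (r + 1) := by
      rw [← pow_mul, mul_comm (2 + r), pow_mul]; norm_num; ring
    have h2 : Q ^ 6 = 531441 ^ (r + 1) := by rw [hQ, ← pow_mul, mul_comm, pow_mul]; norm_num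
    rw [h1, h2]
    exact Nat.mul_le_mul_left _ (Nat.pow_le_pow_left (by norm_num) _)
  have hge : 147456 ≤ 384 ^ (2 + r) := by
    rw [pow_add]; have := Nat.one_le_pow r 384 (by norm_num); omega
  have hN : (12 * 384 ^ (2 + r) + 1) ^ 2 ≤ 145 * 147456 * Q ^ 6 := by nlinarith
  -- The prime bound is at least 10 d + 7: this is 17 for d = 1 and at least 27 for d ≥ 2. In the
  -- second case the factors at 2 and 3 are used as Q d, to supply d².
  rcases hd.eq_or_lt with rfl | hd
  · have h2 := prod_le_periodBound (d := 1) (s := 2 + r) {2, 3, 5, 7, 11, 13, 17}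
      (fun p ↦ p * (3 * Q))
      (by intro p hp; simp only [Finset.mem_insert, Finset.mem_singleton] at hp
          rcases hp with rfl | rfl | rfl | rfl | rfl | rfl | rfl <;>
            exact ⟨by norm_num, by omega⟩)
      (by rw [h3]; simp)
    refine le_trans ?_ h2
    simp
    have e : 2 * (6 * 384 ^ (2 + r)) + 1 = 12 * 384 ^ (2 + r) + 1 := by ring
    rw [e]
    calc _ ≤ 360 * (145 * 147456 * Q ^ 6) := Nat.mul_le_mul_left _ hN
      _ ≤ 1116485370 * 9 * Q ^ 6 := by nlinarith [pow_pos (show 0 < Q by omega) 6]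
      _ ≤ 1116485370 * Q * Q ^ 6 := by gcongr
      _ = _ := by ring
  · have h2 := prod_le_periodBound (d := d) (s := 2 + r) {2, 3, 5, 7, 11, 13, 17, 19, 23}
      (fun p ↦ if p < 5 then Q * d else p * (3 * Q))
      (by intro p hp; simp only [Finset.mem_insert, Finset.mem_singleton] at hp
          rcases hp with rfl | rfl | rfl | rfl | rfl | rfl | rfl | rfl | rfl <;>
            exact ⟨by norm_num, by omega⟩)
      (by rw [h3]; intro p hp; split_ifs
          · exact le_max_of_le_left hbQ.1
          · exact le_max_right _ _)
    refine le_trans ?_ h2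
    simp
    have e : 2 * (6 * 384 ^ (2 + r)) + (2 * d - 1) ≤ (12 * 384 ^ (2 + r) + 1) * d := by
      obtain ⟨c, rfl⟩ := Nat.exists_eq_add_of_le hd.le
      have : 2 * (1 + c) - 1 = 2 * c + 1 := by omega
      rw [this]
      nlinarith
    calc _ ≤ 360 * ((12 * 384 ^ (2 + r) + 1) * d) ^ 2 := by gcongr
      _ = 360 * d ^ 2 * (12 * 384 ^ (2 + r) + 1) ^ 2 := by ring
      _ ≤ 360 * d ^ 2 * (145 * 147456 * Q ^ 6) := Nat.mul_le_mul_left _ hN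
      _ = 7697203200 * (d ^ 2 * Q ^ 6) := by ring
      _ ≤ (2187 * 37182145 * (Q ^ 3)) * (d ^ 2 * Q ^ 6) := by
        gcongr
        have : 1 ≤ Q ^ 3 := Nat.one_le_pow _ _ (by omega)
        omega
      _ = _ := by ring

end Sieve

section Multiplicity

/-! ### A packing bound for vectors of natural numbers -/

/-- A slack coordinate makes the sum exactly m. The vectors are then multisets of size m on |T| + 1
symbols, counted by a binomial coefficient with upper index m + |T|. -/
theorem card_le_two_pow_mul_of_injOn {ι T X : Type*} [Fintype T] [Fintype X] (Z : Finset ι)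
    (τ : ι → X) (v : ι → T → ℕ) (m : ℕ) (hv : ∀ i ∈ Z, ∑ t, v i t ≤ m)
    (hinj : ∀ i ∈ Z, ∀ j ∈ Z, τ i = τ j → v i = v j → i = j) :
    Z.card ≤ Fintype.card X * 2 ^ (m + Fintype.card T) := by
  classical
  let u : Z → {P : Option T → ℕ // ∑ a, P a = m} := fun i ↦
    ⟨fun a ↦ a.elim (m - ∑ t, v i t) (v i), by
      rw [Fintype.sum_option]
      have := hv i i.2
      simp only [Option.elim_none, Option.elim_some]
      omega⟩
  have hf : Function.Injective
      (fun i : Z ↦ (τ i, (Sym.equivNatSumOfFintype (Option T) m).symm (u i))) := by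
    rintro i j hij
    simp only [Prod.mk.injEq, EmbeddingLike.apply_eq_iff_eq] at hij
    refine Subtype.ext (hinj i i.2 j j.2 hij.1 (funext fun t ↦ ?_))
    exact congrFun (congrArg Subtype.val hij.2) (some t)
  have hcard := Fintype.card_le_of_injective _ hf
  rw [Fintype.card_coe, Fintype.card_prod, Sym.card_sym_eq_choose, Fintype.card_option] at hcard
  refine hcard.trans (Nat.mul_le_mul_left _ ((Nat.choose_le_two_pow _ _).trans ?_))
  exact Nat.pow_le_pow_right (by norm_num) (by omega)

/-- Vectors `e i`, whose blocks have at most one nonzero entry and whose sums are controlled by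
`A` and by the heights `H i`, and of which any two are far apart: there are few of them. -/
theorem card_le_of_gap {ι T : Type*} [Fintype T] (Z : Finset ι) (e : ι → T → Fin 3 → ℕ)
    (H : ι → ℕ) (A : ℕ) (hT : 2 ≤ Fintype.card T)
    (hblock : ∀ i ∈ Z, ∀ t, ∀ a b, a ≠ b → e i t a = 0 ∨ e i t b = 0)
    (hsum : ∀ i ∈ Z, 3 * H i = A + ∑ t, ∑ a, e i t a)
    (habc : ∀ i ∈ Z, H i + 2 ≤ A + Fintype.card T)
    (hpos : ∀ i ∈ Z, 1 ≤ H i)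
    (hgap : ∀ i ∈ Z, ∀ j ∈ Z, i ≠ j → A + ∑ t, ∑ a, min (e i t a) (e j t a) ≤ H i + H j) :
    Z.card ≤ 3 ^ Fintype.card T * 2 ^ (7 * Fintype.card T - 6) := by
  classical
  set σ := Fintype.card T with hσ
  -- Each block has at most one nonzero entry: τ records its position (2 if there is none) and N its
  -- size.
  let τ : ι → T → Fin 3 := fun i t ↦ if e i t 0 ≠ 0 then 0 else if e i t 1 ≠ 0 then 1 else 2
  let N : ι → T → ℕ := fun i t ↦ ∑ a, e i t a
  -- The cell width balances two needs: σ (w - 1) ≤ 2A/3 makes two vectors in one cell violate the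
  -- gap, and 2A < 3σw keeps the number of cells independent of A.
  set w := 2 * A / (3 * σ) + 1 with hw
  have hw0 : 1 ≤ w := by rw [hw]; exact Nat.le_add_left _ _
  have hw1 : 3 * σ * (w - 1) ≤ 2 * A := by
    rw [hw, Nat.add_sub_cancel]; exact Nat.mul_div_le _ _
  have hw2 : 2 * A < 3 * σ * w := by
    rw [hw]; exact Nat.lt_mul_div_succ _ (by omega)
  have hmin : ∀ i ∈ Z, ∀ j ∈ Z, ∀ t, τ i t = τ j t →
      ∑ a, min (e i t a) (e j t a) = min (N i t) (N j t) := by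
    intro i hi j hj t hτ
    have h01 := hblock i hi t 0 1 (by decide)
    have h02 := hblock i hi t 0 2 (by decide)
    have h12 := hblock i hi t 1 2 (by decide)
    have g01 := hblock j hj t 0 1 (by decide)
    have g02 := hblock j hj t 0 2 (by decide)
    have g12 := hblock j hj t 1 2 (by decide)
    simp only [τ, N, Fin.sum_univ_three] at hτ ⊢
    split_ifs at hτ <;> omega
  have hcell : ∀ i ∈ Z, ∑ t, N i t / w ≤ 6 * σ - 6 := by
    intro i hi
    have h1 : w * ∑ t, N i t / w ≤ ∑ t, N i t := by
      rw [Finset.mul_sum]; exact Finset.sum_le_sum fun t _ ↦ Nat.mul_div_le _ _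
    have h2 := hsum i hi
    have h3 := habc i hi
    have h4 : w * ∑ t, N i t / w + 6 < 3 * σ * w + 3 * σ := by simp only [N] at h1 ⊢; omega
    by_contra! hlt
    have h5 : w * (6 * σ - 5) ≤ w * ∑ t, N i t / w := Nat.mul_le_mul_left _ (by omega)
    obtain ⟨c, hc⟩ := Nat.exists_eq_add_of_le hT
    have h6 : 6 * σ - 5 = 6 * c + 7 := by omega
    rw [h6] at h5
    rw [hc] at h4
    nlinarith
  have hinj : ∀ i ∈ Z, ∀ j ∈ Z, τ i = τ j → (fun t ↦ N i t / w) = (fun t ↦ N j t / w) →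
      i = j := by
    intro i hi j hj hτ hN
    by_contra hij
    have h1 := hgap i hi j hj hij
    rw [Finset.sum_congr rfl fun t _ ↦ hmin i hi j hj t (congrFun hτ t)] at h1
    -- Within a cell entries differ by at most w - 1. Together with the height identity and the gap,
    -- this yields A/3 + ∑ min ≤ 0. Then A = 0, w = 1, both vectors vanish and the height is 0,
    -- against `hpos`.
    have h2 : ∑ t, (N i t + N j t) ≤ ∑ t, (2 * min (N i t) (N j t) + (w - 1)) := by
      refine Finset.sum_le_sum fun t _ ↦ ?_
      have h3 : N i t / w = N j t / w := congrFun hN t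
      have h4 := Nat.div_add_mod (N i t) w
      have h5 := Nat.div_add_mod (N j t) w
      have h6 := Nat.mod_lt (N i t) (show w > 0 from hw0)
      have h7 := Nat.mod_lt (N j t) (show w > 0 from hw0)
      rw [h3] at h4
      omega
    have h2' : ∑ t, min (N i t) (N j t) ≤ ∑ t, N i t :=
      Finset.sum_le_sum fun t _ ↦ min_le_left _ _
    rw [Finset.sum_add_distrib, Finset.sum_add_distrib, ← Finset.mul_sum, Finset.sum_const,
      Finset.card_univ, ← hσ, smul_eq_mul] at h2
    have h3 := hsum i hi
    have h4 := hsum j hj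
    have h5 := hpos i hi
    have h6 : 3 * σ * (w - 1) = 3 * (σ * (w - 1)) := by ring
    simp only [N] at h1 h2 h2' h6
    omega
  have := card_le_two_pow_mul_of_injOn Z τ (fun i t ↦ N i t / w) (6 * σ - 6) hcell hinj
  rw [Fintype.card_fun, Fintype.card_fin, ← hσ] at this
  rwa [show 7 * σ - 6 = 6 * σ - 6 + σ by omega]

/-! ### Multiplicities of roots over an algebraically closed field -/

variable {k : Type*} [Field k]

theorem sum_rootMultiplicity_le (f : k[X]) (B : Finset k) :
    ∑ α ∈ B, f.rootMultiplicity α ≤ f.natDegree := by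
  classical
  refine le_trans ?_ (card_roots' f)
  simp_rw [← count_roots]
  rw [← Multiset.toFinset_sum_count_eq]
  calc ∑ α ∈ B, f.roots.count α ≤ ∑ α ∈ B ∪ f.roots.toFinset, f.roots.count α :=
        Finset.sum_le_sum_of_subset Finset.subset_union_left
    _ = _ := (Finset.sum_subset Finset.subset_union_right fun α _ h ↦ Multiset.count_eq_zero.2
        fun h' ↦ h (Multiset.mem_toFinset.2 h')).symm

theorem sum_rootMultiplicity_eq [IsAlgClosed k] {f : k[X]} {B : Finset k}
    (hB : ∀ α, f.rootMultiplicity α ≠ 0 → α ∈ B) :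
    ∑ α ∈ B, f.rootMultiplicity α = f.natDegree := by
  classical
  rw [(IsAlgClosed.splits f).natDegree_eq_card_roots, ← Multiset.toFinset_sum_count_eq]
  simp_rw [← count_roots]
  refine (Finset.sum_subset (fun α hα ↦ hB α ?_) fun α _ h ↦ ?_).symm
  · rw [← count_roots]
    exact Multiset.count_ne_zero.2 (Multiset.mem_toFinset.1 hα)
  · exact Multiset.count_eq_zero.2 fun h' ↦ h (Multiset.mem_toFinset.2 h')

theorem natDegree_radical_le_card [IsAlgClosed k] [DecidableEq k] {f : k[X]} (hf : f ≠ 0) :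
    (UniqueFactorizationMonoid.radical f).natDegree ≤ f.roots.toFinset.card := by
  set r := UniqueFactorizationMonoid.radical f with hr
  have hr0 : r ≠ 0 := UniqueFactorizationMonoid.radical_ne_zero
  have hdvd : r ∣ f := UniqueFactorizationMonoid.radical_dvd_self
  have hnodup : r.roots.Nodup := by
    rw [Multiset.nodup_iff_count_le_one]
    intro α
    rw [count_roots]
    by_contra! h
    have h1 : (X - C α) * (X - C α) ∣ r := by
      rw [← sq]
      exact (le_rootMultiplicity_iff hr0).1 h
    exact not_isUnit_X_sub_C α (UniqueFactorizationMonoid.squarefree_radical _ h1)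
  rw [(IsAlgClosed.splits r).natDegree_eq_card_roots, ← Multiset.toFinset_card_of_nodup hnodup]
  exact Finset.card_le_card fun α hα ↦ Multiset.mem_toFinset.2
    (Multiset.mem_of_le (roots.le_of_dvd hf hdvd) (Multiset.mem_toFinset.1 hα))

theorem rootMultiplicity_eq_zero_or_of_isCoprime {f g : k[X]} (h : IsCoprime f g) (α : k) :
    f.rootMultiplicity α = 0 ∨ g.rootMultiplicity α = 0 := by
  by_contra! hc
  obtain ⟨a, b, hab⟩ := h
  have h1 : f.eval α = 0 := (rootMultiplicity_pos'.1 (Nat.pos_of_ne_zero hc.1)).2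
  have h2 : g.eval α = 0 := (rootMultiplicity_pos'.1 (Nat.pos_of_ne_zero hc.2)).2
  have := congrArg (eval α) hab
  simp [h1, h2] at this

end Multiplicity

section Counting

variable {k : Type*} [Field k]

/-! ### Counting coprime solutions of `F + G = L` with prescribed multiplicities -/

/-- At most one entry of `u` is nonzero, so the sum reduces to a single term. -/
theorem add_sum_min_le_of_le {x y : ℕ} {u v : Fin 3 → ℕ}
    (hu : ∀ a b, a ≠ b → u a = 0 ∨ u b = 0) (h : ∀ a, x + min (u a) (v a) ≤ y) :
    x + ∑ a, min (u a) (v a) ≤ y := by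
  have h01 := hu 0 1 (by decide)
  have h02 := hu 0 2 (by decide)
  have h12 := hu 1 2 (by decide)
  have h0 := h 0
  have h1 := h 1
  have h2 := h 2
  rw [Fin.sum_univ_three]
  omega

theorem card_le_of_rootMultiplicity_eq [IsAlgClosed k] [CharZero k] (S : Finset k)
    (hS : S.Nonempty) {ι : Type*} (Z : Finset ι) (W : ι → Fin 3 → k[X])
    (hne : ∀ i ∈ Z, ∀ a, W i a ≠ 0) (hadd : ∀ i ∈ Z, W i 0 + W i 1 = W i 2)
    (hcop : ∀ i ∈ Z, IsCoprime (W i 0) (W i 2))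
    (hconst : ∀ i ∈ Z, ∃ a, (W i a).natDegree ≠ 0)
    (hmult : ∀ i ∈ Z, ∀ j ∈ Z, ∀ α ∉ S, ∀ a,
      (W i a).rootMultiplicity α = (W j a).rootMultiplicity α)
    (hdet : ∀ i ∈ Z, ∀ j ∈ Z, i ≠ j → W i 0 * W j 2 ≠ W j 0 * W i 2) :
    Z.card ≤ 3 ^ (S.card + 1) * 2 ^ (7 * (S.card + 1) - 6) := by
  classical
  rcases Z.eq_empty_or_nonempty with rfl | ⟨i₀, hi₀⟩
  · simp
  have hcop' : ∀ i ∈ Z, ∀ a b, a ≠ b → IsCoprime (W i a) (W i b) := by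
    intro i hi
    have h02 := hcop i hi
    have h12 : IsCoprime (W i 1) (W i 2) := by
      have h : W i 1 = - W i 0 + W i 2 * 1 := by rw [← hadd i hi]; ring
      rw [h, IsCoprime.add_mul_left_left_iff]
      exact h02.neg_left
    have h01 : IsCoprime (W i 0) (W i 1) := by
      have h : W i 1 = W i 2 + W i 0 * (-1) := by rw [← hadd i hi]; ring
      rw [h, IsCoprime.add_mul_left_right_iff]
      exact h02
    intro a b hab
    fin_cases a <;> fin_cases b <;>
      first | exact absurd rfl hab | assumption | exact h01.symm | exact h02.symm | exact h12.symm
  let H : ι → ℕ := fun i ↦ max (max (W i 0).natDegree (W i 1).natDegree) (W i 2).natDegree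
  have hH : ∀ i a, (W i a).natDegree ≤ H i := by
    intro i a
    fin_cases a <;> simp [H]
  -- In F + G = L the top degree is attained at least twice.
  have hHtwo : ∀ i ∈ Z, ∀ a b, a ≠ b → H i - (W i a).natDegree = 0 ∨
      H i - (W i b).natDegree = 0 := by
    intro i hi
    have h2 := natDegree_add_le (W i 0) (W i 1)
    have h1 := natDegree_sub_le (W i 2) (W i 0)
    have h0 := natDegree_sub_le (W i 2) (W i 1)
    rw [hadd i hi] at h2
    rw [← hadd i hi, add_sub_cancel_left, hadd i hi] at h1
    rw [← hadd i hi, add_sub_cancel_right, hadd i hi] at h0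
    intro a b hab
    fin_cases a <;> fin_cases b <;>
      first | exact absurd rfl hab | (simp only [H]; simp; omega)
  let B : Finset k := (Finset.univ.biUnion fun a ↦ (W i₀ a).roots.toFinset) \ S
  have hB : ∀ i ∈ Z, ∀ a α, (W i a).rootMultiplicity α ≠ 0 → α ∈ S ∪ B := by
    intro i hi a α h
    rw [Finset.mem_union]
    by_cases hα : α ∈ S
    · exact Or.inl hα
    · refine Or.inr (Finset.mem_sdiff.2 ⟨Finset.mem_biUnion.2 ⟨a, Finset.mem_univ _, ?_⟩, hα⟩)
      rw [hmult i hi i₀ hi₀ α hα, ← count_roots, Multiset.count_ne_zero] at h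
      exact Multiset.mem_toFinset.2 h
  have hdisj : Disjoint S B := Finset.disjoint_sdiff
  have hBS : ∀ {α}, α ∈ B → α ∉ S := fun h ↦ (Finset.mem_sdiff.1 h).2
  let A : ℕ := ∑ α ∈ B, ∑ a, (W i₀ a).rootMultiplicity α
  have hA : ∀ i ∈ Z, A = ∑ α ∈ B, ∑ a, (W i a).rootMultiplicity α := fun i hi ↦
    Finset.sum_congr rfl fun α hα ↦ Finset.sum_congr rfl fun a _ ↦
      hmult i₀ hi₀ i hi α (hBS hα) a
  have hBA : B.card ≤ A := by
    rw [Finset.card_eq_sum_ones]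
    refine Finset.sum_le_sum fun α hα ↦ ?_
    obtain ⟨a, -, ha⟩ := Finset.mem_biUnion.1 (Finset.mem_sdiff.1 hα).1
    have h1 := Multiset.count_pos.2 (Multiset.mem_toFinset.1 ha)
    rw [count_roots] at h1
    exact (Nat.succ_le_of_lt h1).trans (Finset.single_le_sum (f := fun a ↦ (W i₀ a).rootMultiplicity α)
      (fun _ _ ↦ Nat.zero_le _) (Finset.mem_univ a))
  have hmul0 : ∀ i ∈ Z, ∀ α a b, a ≠ b → (W i a).rootMultiplicity α = 0 ∨
      (W i b).rootMultiplicity α = 0 := fun i hi α a b hab ↦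
    rootMultiplicity_eq_zero_or_of_isCoprime (hcop' i hi a b hab) α
  -- `none` is the place at infinity, where the order of vanishing is the degree defect.
  let e : ι → Option S → Fin 3 → ℕ := fun i t a ↦
    t.elim (H i - (W i a).natDegree) fun α ↦ (W i a).rootMultiplicity (α : k)
  have hcard : Fintype.card (Option S) = S.card + 1 := by simp
  have key := card_le_of_gap Z e H A (by have := hS.card_pos; omega)
    ?_ ?_ ?_ ?_ ?_
  · rwa [hcard] at key
  · rintro i hi (_ | α) a b hab
    · exact hHtwo i hi a b hab
    · exact hmul0 i hi α a b hab
  · intro i hi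
    have hdeg : ∀ a, (W i a).natDegree = ∑ α ∈ S, (W i a).rootMultiplicity α +
        ∑ α ∈ B, (W i a).rootMultiplicity α := fun a ↦ by
      rw [← Finset.sum_union hdisj, sum_rootMultiplicity_eq (hB i hi a)]
    have h1 : ∑ α : S, ∑ a, e i (some α) a = ∑ α ∈ S, ∑ a, (W i a).rootMultiplicity α :=
      Finset.sum_coe_sort S fun α ↦ ∑ a, (W i a).rootMultiplicity α
    rw [Fintype.sum_option, h1, hA i hi, Finset.sum_comm (s := B), Finset.sum_comm (s := S)]
    simp only [e, Option.elim_none, Fin.sum_univ_three]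
    have h0 := hdeg 0
    have h1 := hdeg 1
    have h2 := hdeg 2
    have g0 := hH i 0
    have g1 := hH i 1
    have g2 := hH i 2
    omega
  · intro i hi
    rw [hcard]
    -- Mason–Stothers: the height is less than the number of distinct zeros, which is at most |S| +
    -- |B| ≤ |S| + A. In characteristic zero the alternative of vanishing derivatives means
    -- constants.
    have habc := Polynomial.abc (hne i hi 0) (hne i hi 1) (neg_ne_zero.2 (hne i hi 2))
      (hcop' i hi 0 1 (by decide)) (by rw [hadd i hi]; ring)
    have hprod : W i 0 * W i 1 * -W i 2 ≠ 0 :=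
      mul_ne_zero (mul_ne_zero (hne i hi 0) (hne i hi 1)) (neg_ne_zero.2 (hne i hi 2))
    have hrad := natDegree_radical_le_card hprod
    have hroots : (W i 0 * W i 1 * -W i 2).roots.toFinset.card ≤ S.card + B.card := by
      rw [← Finset.card_union_of_disjoint hdisj]
      refine Finset.card_le_card fun α hα ↦ ?_
      rw [Multiset.mem_toFinset, mem_roots hprod, IsRoot.def, eval_mul, eval_mul, eval_neg,
        mul_eq_zero, mul_eq_zero, neg_eq_zero] at hα
      have h : ∀ a, (W i a).eval α = 0 → α ∈ S ∪ B := fun a ha ↦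
        hB i hi a α ((rootMultiplicity_pos (hne i hi a)).2 ha).ne'
      rcases hα with (h' | h') | h'
      exacts [h 0 h', h 1 h', h 2 h']
    rcases habc with ⟨h0, h1, h2⟩ | ⟨h0, h1, h2⟩
    · rw [natDegree_neg] at h2
      simp only [H]
      omega
    · rw [derivative_neg, neg_eq_zero] at h2
      obtain ⟨a, ha⟩ := hconst i hi
      refine absurd (derivative_eq_zero.1 ?_) ha
      fin_cases a
      exacts [h0, h1, h2]
  · intro i hi
    obtain ⟨a, ha⟩ := hconst i hi
    exact (Nat.one_le_iff_ne_zero.2 ha).trans (hH i a)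
  · intro i hi j hj hij
    -- By F + G = L this determinant is, up to sign, the same for any two of the three components.
    -- So it vanishes to the common order of each component at every point, including infinity, and
    -- its degree is at most the sum of the heights.
    set Δ := W i 0 * W j 2 - W j 0 * W i 2 with hΔ
    have hΔ0 : Δ ≠ 0 := sub_ne_zero.2 (hdet i hi j hj hij)
    have hΔ1 : Δ = W j 1 * W i 2 - W i 1 * W j 2 := by
      rw [hΔ, ← hadd i hi, ← hadd j hj]; ring
    have hmΔ : ∀ α, ∑ a, min ((W i a).rootMultiplicity α) ((W j a).rootMultiplicity α) ≤
        Δ.rootMultiplicity α := by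
      intro α
      rw [← zero_add (∑ a, _)]
      refine add_sum_min_le_of_le (hmul0 i hi α) fun a ↦ ?_
      rw [zero_add, le_rootMultiplicity_iff hΔ0]
      have h1 : (X - C α) ^ min ((W i a).rootMultiplicity α) ((W j a).rootMultiplicity α) ∣
          W i a := (le_rootMultiplicity_iff (hne i hi a)).1 (min_le_left _ _)
      have h2 : (X - C α) ^ min ((W i a).rootMultiplicity α) ((W j a).rootMultiplicity α) ∣
          W j a := (le_rootMultiplicity_iff (hne j hj a)).1 (min_le_right _ _)
      fin_cases a
      · exact dvd_sub (h1.mul_right _) (h2.mul_right _)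
      · rw [hΔ1]
        exact dvd_sub (h2.mul_right _) (h1.mul_right _)
      · exact dvd_sub (h2.mul_left _) (h1.mul_left _)
    have hdΔ : Δ.natDegree + ∑ a, min (H i - (W i a).natDegree) (H j - (W j a).natDegree) ≤
        H i + H j := by
      refine add_sum_min_le_of_le (hHtwo i hi) fun a ↦ ?_
      have hd : ∀ p q r s : k[X], (p * q - r * s).natDegree ≤
          max (p.natDegree + q.natDegree) (r.natDegree + s.natDegree) := fun p q r s ↦
        (natDegree_sub_le _ _).trans (max_le_max natDegree_mul_le natDegree_mul_le)
      have h0 := hd (W i 0) (W j 2) (W j 0) (W i 2)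
      have h1 := hd (W j 1) (W i 2) (W i 1) (W j 2)
      rw [← hΔ] at h0
      rw [← hΔ1] at h1
      have := hH i 0
      have := hH i 1
      have := hH i 2
      have := hH j 0
      have := hH j 1
      have := hH j 2
      fin_cases a <;> simp <;> omega
    have h1 : ∑ α : S, ∑ a, min (e i (some α) a) (e j (some α) a) =
        ∑ α ∈ S, ∑ a, min ((W i a).rootMultiplicity α) ((W j a).rootMultiplicity α) :=
      Finset.sum_coe_sort S
        fun α ↦ ∑ a, min ((W i a).rootMultiplicity α) ((W j a).rootMultiplicity α)
    have h2 : A = ∑ α ∈ B, ∑ a, min ((W i a).rootMultiplicity α)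
        ((W j a).rootMultiplicity α) := by
      rw [hA i hi]
      refine Finset.sum_congr rfl fun α hα ↦ Finset.sum_congr rfl fun a _ ↦ ?_
      rw [hmult i hi j hj α (hBS hα), min_self]
    have h3 := (Finset.sum_le_sum fun α (_ : α ∈ S ∪ B) ↦ hmΔ α).trans
      (sum_rootMultiplicity_le Δ (S ∪ B))
    rw [Finset.sum_union hdisj, ← h2] at h3
    rw [Fintype.sum_option, h1]
    simp only [e, Option.elim_none]
    omega

end Counting

section Places

variable {k : Type*} [Field k]

/-! ### Valuations of rational functions and multiplicities -/

theorem placeVal_coe_X_sub_C (α : k) :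
    0 < placeVal (some α) (algebraMap k[X] (RatFunc k) (X - C α)) ∧
      placeVal (some α) (algebraMap k[X] (RatFunc k) (X - C α)) < 1 := by
  constructor
  · rw [Valuation.pos_iff]
    exact (map_ne_zero_iff _ (RatFunc.algebraMap_injective k)).2 (X_sub_C_ne_zero α)
  · exact ((pointPrime α).valuation_lt_one_iff_mem _).2 (Ideal.mem_span_singleton_self _)

theorem placeVal_coe_algebraMap (α : k) {f : k[X]} (hf : f ≠ 0) :
    placeVal (some α) (algebraMap k[X] (RatFunc k) f) =
      placeVal (some α) (algebraMap k[X] (RatFunc k) (X - C α)) ^ f.rootMultiplicity α := by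
  obtain ⟨g, hg, hd⟩ := exists_eq_pow_rootMultiplicity_mul_and_not_dvd f hf α
  have h1 : placeVal (some α) (algebraMap k[X] (RatFunc k) g) = 1 := by
    refine (pointPrime α).valuation_eq_one_iff_notMem.2 ?_
    rwa [pointPrime, Ideal.mem_span_singleton]
  conv_lhs => rw [hg]
  rw [map_mul, map_mul, map_pow, map_pow, h1, mul_one]

theorem rootMultiplicity_add_eq_of_placeVal_div_eq {α : k} {f g f' g' : k[X]} (hf : f ≠ 0)
    (hg : g ≠ 0) (hf' : f' ≠ 0) (hg' : g' ≠ 0)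
    (h : placeVal (some α) (algebraMap k[X] (RatFunc k) f / algebraMap k[X] (RatFunc k) g) =
      placeVal (some α) (algebraMap k[X] (RatFunc k) f' / algebraMap k[X] (RatFunc k) g')) :
    f.rootMultiplicity α + g'.rootMultiplicity α =
      f'.rootMultiplicity α + g.rootMultiplicity α := by
  obtain ⟨h0, h1⟩ := placeVal_coe_X_sub_C α
  rw [map_div₀, map_div₀, placeVal_coe_algebraMap α hf, placeVal_coe_algebraMap α hg,
    placeVal_coe_algebraMap α hf', placeVal_coe_algebraMap α hg',
    div_eq_div_iff (pow_ne_zero _ h0.ne') (pow_ne_zero _ h0.ne'), ← pow_add, ← pow_add] at h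
  exact (pow_right_strictAnti₀ h0 h1).injective h

theorem mem_range_C_of_natDegree_eq_zero {z : RatFunc k} (h0 : z.num.natDegree = 0)
    (h1 : z.denom.natDegree = 0) : z ∈ Set.range (RatFunc.C : k →+* RatFunc k) := by
  rw [natDegree_eq_zero] at h0 h1
  obtain ⟨a, ha⟩ := h0
  obtain ⟨b, hb⟩ := h1
  refine ⟨a / b, ?_⟩
  rw [← RatFunc.num_div_denom z, ← ha, ← hb, map_div₀, RatFunc.algebraMap_C, RatFunc.algebraMap_C]

theorem eq_of_num_mul_denom_eq {z w : RatFunc k} (h : z.num * w.denom = w.num * z.denom) :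
    z = w := by
  rw [← RatFunc.num_div_denom z, ← RatFunc.num_div_denom w,
    div_eq_div_iff (RatFunc.algebraMap_ne_zero z.denom_ne_zero)
      (RatFunc.algebraMap_ne_zero w.denom_ne_zero), ← map_mul, ← map_mul, h]

/-- A rational function which is a unit at all places but one is constant. -/
theorem mem_range_C_of_placeVal_eq_one [IsAlgClosed k] {z : RatFunc k} (hz : z ≠ 0)
    (𝔮 : OnePoint k) (h : ∀ 𝔭, 𝔭 ≠ 𝔮 → placeVal 𝔭 z = 1) :
    z ∈ Set.range (RatFunc.C : k →+* RatFunc k) := by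
  have hn := RatFunc.num_ne_zero hz
  have hd := z.denom_ne_zero
  have hcop := rootMultiplicity_eq_zero_or_of_isCoprime z.isCoprime_num_denom
  have hfin : ∀ α : k, (some α : OnePoint k) ≠ 𝔮 →
      z.num.rootMultiplicity α = z.denom.rootMultiplicity α := by
    intro α hα
    have h1 := h _ hα
    rw [← RatFunc.num_div_denom z] at h1
    have := rootMultiplicity_add_eq_of_placeVal_div_eq (α := α) hn hd (one_ne_zero)
      (one_ne_zero) (by rw [h1]; simp)
    rw [← C_1, rootMultiplicity_C] at this
    omega
  rcases 𝔮 with _ | α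
  · have h0 : ∀ f : k[X], (∀ α, f.rootMultiplicity α = 0) → f.natDegree = 0 := by
      intro f hf
      rw [← sum_rootMultiplicity_eq (f := f) (B := ∅) (by simp [hf]), Finset.sum_empty]
    refine mem_range_C_of_natDegree_eq_zero (h0 _ fun α ↦ ?_) (h0 _ fun α ↦ ?_) <;>
    · have h1 := hfin α (by simp)
      have h2 := hcop α
      omega
  · have h0 : ∀ β, β ≠ α → z.num.rootMultiplicity β = 0 ∧ z.denom.rootMultiplicity β = 0 := by
      intro β hβ
      have h1 := hfin β (by simpa using hβ)
      have h2 := hcop β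
      omega
    have hnum : z.num.rootMultiplicity α = z.num.natDegree := by
      rw [← sum_rootMultiplicity_eq (f := z.num) (B := {α}), Finset.sum_singleton]
      intro β hβ
      by_contra hne
      exact hβ (h0 β (by simpa using hne)).1
    have hden : z.denom.rootMultiplicity α = z.denom.natDegree := by
      rw [← sum_rootMultiplicity_eq (f := z.denom) (B := {α}), Finset.sum_singleton]
      intro β hβ
      by_contra hne
      exact hβ (h0 β (by simpa using hne)).2
    have hdeg : z.num.natDegree = z.denom.natDegree := by
      classical
      have h1 := h none (Option.some_ne_none α).symm
      rw [placeVal, RatFunc.inftyValuation_apply, RatFunc.inftyValuation_of_nonzero k hz, WithZero.exp_eq_one,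
        RatFunc.intDegree] at h1
      omega
    have h2 := hcop α
    exact mem_range_C_of_natDegree_eq_zero (by omega) (by omega)

/-- The number of nonconstant `z` such that `z` and `1 - z` have given valuations at all places
outside a finite set `S` is bounded in terms of the cardinality of `S`. -/
theorem card_le_of_placeVal_eq [IsAlgClosed k] [CharZero k] (S : Finset (OnePoint k))
    (hS : 2 ≤ S.card) (Z : Finset (RatFunc k))
    (hZ : ∀ z ∈ Z, z ∉ Set.range (RatFunc.C : k →+* RatFunc k))
    (hval : ∀ z ∈ Z, ∀ w ∈ Z, ∀ 𝔭 ∉ S, placeVal 𝔭 z = placeVal 𝔭 w ∧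
      placeVal 𝔭 (1 - z) = placeVal 𝔭 (1 - w)) :
    Z.card ≤ 6 * 384 ^ S.card := by
  classical
  -- The polynomial count always allows infinity as an exceptional place, so only the finite places
  -- of S matter. Since |S| ≥ 2, there is at least one.
  let S₀ : Finset k := S.preimage some (Option.some_injective k).injOn
  have hmem : ∀ {α : k}, α ∈ S₀ ↔ (some α : OnePoint k) ∈ S := Finset.mem_preimage
  have hcard : S₀.card ≤ S.card :=
    Finset.card_le_card_of_injOn some (fun α hα ↦ hmem.1 hα) (Option.some_injective k).injOn
  have hne : S₀.Nonempty := by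
    obtain ⟨x, hx, y, hy, hxy⟩ := Finset.one_lt_card.1 hS
    rcases x with _ | α
    · rcases y with _ | β
      · exact absurd rfl hxy
      · exact ⟨β, hmem.2 hy⟩
    · exact ⟨α, hmem.2 hx⟩
  have hz0 : ∀ z ∈ Z, z ≠ 0 := fun z hz h ↦ hZ z hz ⟨0, by rw [h, map_zero]⟩
  have hz1 : ∀ z ∈ Z, z.denom - z.num ≠ 0 := by
    intro z hz h
    refine hZ z hz ⟨1, ?_⟩
    rw [map_one, ← RatFunc.num_div_denom z, sub_eq_zero.1 h,
      div_self (RatFunc.algebraMap_ne_zero (by rw [← sub_eq_zero.1 h]; exact z.denom_ne_zero))]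
  have hone : ∀ z : RatFunc k, 1 - z =
      algebraMap k[X] (RatFunc k) (z.denom - z.num) / algebraMap k[X] (RatFunc k) z.denom := by
    intro z
    rw [map_sub, sub_div, div_self (RatFunc.algebraMap_ne_zero z.denom_ne_zero),
      RatFunc.num_div_denom]
  have key := card_le_of_rootMultiplicity_eq S₀ hne Z
    (fun z ↦ ![z.num, z.denom - z.num, z.denom]) ?_ ?_ ?_ ?_ ?_ ?_
  · refine key.trans ?_
    have h1 : 7 * (S₀.card + 1) - 6 = 7 * S₀.card + 1 := by omega
    rw [h1]
    calc 3 ^ (S₀.card + 1) * 2 ^ (7 * S₀.card + 1) = 6 * 384 ^ S₀.card := by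
          rw [pow_succ, pow_succ, pow_mul, show (384 : ℕ) = 3 * 2 ^ 7 by norm_num, mul_pow]; ring
      _ ≤ _ := Nat.mul_le_mul_left _ (Nat.pow_le_pow_right (by norm_num) hcard)
  · intro z hz a
    fin_cases a
    exacts [RatFunc.num_ne_zero (hz0 z hz), hz1 z hz, z.denom_ne_zero]
  · intro z _
    simp
  · intro z _
    exact z.isCoprime_num_denom
  · intro z hz
    by_contra! h
    exact hZ z hz (mem_range_C_of_natDegree_eq_zero (h 0) (h 2))
  -- Valuations give only differences of multiplicities of numerator and denominator; coprimality
  -- recovers each multiplicity.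
  · intro z hz w hw α hα
    obtain ⟨h1, h2⟩ := hval z hz w hw (some α) fun h ↦ hα (hmem.2 h)
    rw [hone, hone] at h2
    rw [← RatFunc.num_div_denom z, ← RatFunc.num_div_denom w] at h1
    have h3 := rootMultiplicity_add_eq_of_placeVal_div_eq (RatFunc.num_ne_zero (hz0 z hz))
      z.denom_ne_zero (RatFunc.num_ne_zero (hz0 w hw)) w.denom_ne_zero h1
    have h4 := rootMultiplicity_add_eq_of_placeVal_div_eq (hz1 z hz)
      z.denom_ne_zero (hz1 w hw) w.denom_ne_zero h2
    have h5 := rootMultiplicity_eq_zero_or_of_isCoprime z.isCoprime_num_denom α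
    have h6 := rootMultiplicity_eq_zero_or_of_isCoprime w.isCoprime_num_denom α
    intro a
    fin_cases a <;> simp <;> omega
  · intro z _ w _ hzw h
    exact hzw (eq_of_num_mul_denom_eq h)

end Places

/-! ### Binary forms -/

/-- The binary form of degree `m` with coefficients `a`. -/
def homEval {R : Type*} [CommSemiring R] (a : ℕ → R) (m : ℕ) (x y : R) : R :=
  ∑ i ∈ Finset.range (m + 1), a i * x ^ i * y ^ (m - i)

theorem map_homEval {R R' : Type*} [CommSemiring R] [CommSemiring R'] (φ : R →+* R') (a : ℕ → R)
    (m : ℕ) (x y : R) : φ (homEval a m x y) = homEval (fun i ↦ φ (a i)) m (φ x) (φ y) := by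
  simp [homEval]

theorem homEval_smul {R : Type*} [CommSemiring R] (a : ℕ → R) (m : ℕ) (c x y : R) :
    homEval a m (c * x) (c * y) = c ^ m * homEval a m x y := by
  rw [homEval, homEval, Finset.mul_sum]
  refine Finset.sum_congr rfl fun i hi ↦ ?_
  have h : c ^ m = c ^ i * c ^ (m - i) := by
    rw [← pow_add]; congr 1; have := Finset.mem_range.1 hi; omega
  rw [h, mul_pow, mul_pow]
  ring

/-- For each pair of monomials the antisymmetrized difference is a common factor times (x y')^e - (y
x')^e. -/
theorem dvd_homEval_mul_sub {R : Type*} [CommRing R] (a b : ℕ → R) (m : ℕ) (x y x' y' : R) :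
    x * y' - y * x' ∣ homEval a m x y * homEval b m x' y' - homEval b m x y * homEval a m x' y' := by
  have hpow : ∀ i j, j ≤ i → i ≤ m → x * y' - y * x' ∣
      x ^ i * y ^ (m - i) * (x' ^ j * y' ^ (m - j)) -
        x ^ j * y ^ (m - j) * (x' ^ i * y' ^ (m - i)) := by
    intro i j hji him
    obtain ⟨e, rfl⟩ := Nat.exists_eq_add_of_le hji
    have h : m - j = m - (j + e) + e := by omega
    have h1 : x ^ (j + e) * y ^ (m - (j + e)) * (x' ^ j * y' ^ (m - j)) -
        x ^ j * y ^ (m - j) * (x' ^ (j + e) * y' ^ (m - (j + e))) =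
        (x ^ j * x' ^ j * (y ^ (m - (j + e)) * y' ^ (m - (j + e)))) *
          ((x * y') ^ e - (y * x') ^ e) := by
      rw [h, pow_add, pow_add, pow_add, pow_add, mul_pow, mul_pow]; ring
    rw [h1]
    exact (sub_dvd_pow_sub_pow _ _ e).mul_left _
  have hpow' : ∀ i j, i ≤ m → j ≤ m → x * y' - y * x' ∣
      x ^ i * y ^ (m - i) * (x' ^ j * y' ^ (m - j)) -
        x ^ j * y ^ (m - j) * (x' ^ i * y' ^ (m - i)) := by
    intro i j hi hj
    rcases le_total j i with h | h
    · exact hpow i j h hi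
    · rw [← dvd_neg, neg_sub]
      exact hpow j i h hj
  have hsum : homEval a m x y * homEval b m x' y' - homEval b m x y * homEval a m x' y' =
      ∑ i ∈ Finset.range (m + 1), ∑ j ∈ Finset.range (m + 1), a i * b j *
        (x ^ i * y ^ (m - i) * (x' ^ j * y' ^ (m - j)) -
          x ^ j * y ^ (m - j) * (x' ^ i * y' ^ (m - i))) := by
    rw [mul_comm (homEval b m x y)]
    simp only [homEval]
    rw [Finset.sum_mul_sum, Finset.sum_mul_sum, ← Finset.sum_sub_distrib]
    refine Finset.sum_congr rfl fun i _ ↦ ?_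
    rw [← Finset.sum_sub_distrib]
    exact Finset.sum_congr rfl fun j _ ↦ by ring
  rw [hsum]
  refine Finset.dvd_sum fun i hi ↦ Finset.dvd_sum fun j hj ↦ (hpow' i j ?_ ?_).mul_left _
  · have := Finset.mem_range.1 hi; omega
  · have := Finset.mem_range.1 hj; omega

/-! ### Resultants of binary forms and the Sylvester matrix -/

theorem sum_range_ite_shift {R : Type*} [AddCommMonoid R] (h : ℕ → R) {m j : ℕ} (hj : j < m) :
    ∑ i ∈ Finset.range (m + m), (if i ∈ Set.Icc j (j + m) then h i else 0) =
      ∑ c ∈ Finset.range (m + 1), h (j + c) := by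
  rw [← Finset.sum_filter]
  have : (Finset.range (m + m)).filter (· ∈ Set.Icc j (j + m)) = Finset.Ico j (j + m + 1) := by
    ext i
    simp only [Finset.mem_filter, Finset.mem_range, Set.mem_Icc, Finset.mem_Ico]
    omega
  rw [this, Finset.sum_Ico_eq_sum_range]
  congr 2
  omega

theorem sum_sylvester_column {R : Type*} [CommRing R] (f : R[X]) {m j : ℕ} (hj : j < m)
    (x y : R) :
    ∑ i : Fin (m + m), x ^ (i : ℕ) * y ^ (2 * m - 1 - i) *
      (if (i : ℕ) ∈ Set.Icc j (j + m) then f.coeff (i - j) else 0) =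
      x ^ j * y ^ (m - 1 - j) * homEval f.coeff m x y := by
  rw [Fin.sum_univ_eq_sum_range (fun i ↦ x ^ i * y ^ (2 * m - 1 - i) *
    (if i ∈ Set.Icc j (j + m) then f.coeff (i - j) else 0)) (m + m)]
  simp_rw [mul_ite, mul_zero]
  rw [sum_range_ite_shift (fun i ↦ x ^ i * y ^ (2 * m - 1 - i) * f.coeff (i - j)) hj, homEval,
    Finset.mul_sum]
  refine Finset.sum_congr rfl fun c hc ↦ ?_
  have h := Finset.mem_range.1 hc
  rw [Nat.add_sub_cancel_left, show 2 * m - 1 - (j + c) = (m - 1 - j) + (m - c) by omega,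
    pow_add, pow_add]
  ring

/-- The resultant of two forms of degree `m` kills all monomials of degree `2 m - 1` modulo the
two forms. -/
theorem resultant_mul_monomial_mem_span {R : Type*} [CommRing R] (f g : R[X]) (m : ℕ) (x y : R)
    {i : ℕ} (hi : i < m + m) :
    resultant f g m m * (x ^ i * y ^ (2 * m - 1 - i)) ∈
      Ideal.span {homEval f.coeff m x y, homEval g.coeff m x y} := by
  set M := sylvester f g m m
  let w : Fin (m + m) → R := fun i ↦ x ^ (i : ℕ) * y ^ (2 * m - 1 - i)
  have hu : ∀ j, (Matrix.vecMul w M) j ∈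
      Ideal.span {homEval f.coeff m x y, homEval g.coeff m x y} := by
    intro j
    induction j using Fin.addCases with
    | left j =>
      have : Matrix.vecMul w M (Fin.castAdd m j) =
          x ^ (j : ℕ) * y ^ (m - 1 - j) * homEval g.coeff m x y := by
        rw [← sum_sylvester_column g j.2]
        simp only [Matrix.vecMul, dotProduct, w, M, sylvester, Matrix.of_apply, Fin.addCases_left]
      rw [this]
      exact Ideal.mul_mem_left _ _ (Ideal.subset_span (by simp))
    | right j =>
      have : Matrix.vecMul w M (Fin.natAdd m j) =
          x ^ (j : ℕ) * y ^ (m - 1 - j) * homEval f.coeff m x y := by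
        rw [← sum_sylvester_column f j.2]
        simp only [Matrix.vecMul, dotProduct, w, M, sylvester, Matrix.of_apply, Fin.addCases_right]
      rw [this]
      exact Ideal.mul_mem_left _ _ (Ideal.subset_span (by simp))
  -- The row of monomials times the Sylvester matrix consists of multiples of the two forms.
  -- Multiplying by the adjugate turns it back into the determinant times the monomials.
  have h1 : Matrix.vecMul (Matrix.vecMul w M) M.adjugate ⟨i, hi⟩ =
      resultant f g m m * (x ^ i * y ^ (2 * m - 1 - i)) := by
    rw [Matrix.vecMul_vecMul, Matrix.mul_adjugate, Matrix.vecMul_smul, Matrix.vecMul_one]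
    rfl
  rw [← h1, Matrix.vecMul, dotProduct]
  exact Ideal.sum_mem _ fun j _ ↦ Ideal.mul_mem_right _ _ (hu j)

/-! ### Good reduction and normalized coordinates -/

section Valuation

variable {K Γ₀ : Type*} [Field K] [LinearOrderedCommGroupWithZero Γ₀] (v : Valuation K Γ₀)

theorem map_homEval_le_one {a : ℕ → K} (ha : ∀ i, v (a i) ≤ 1) (m : ℕ) {x y : K}
    (hx : v x ≤ 1) (hy : v y ≤ 1) : v (homEval a m x y) ≤ 1 := by
  refine v.map_sum_le fun i _ ↦ ?_
  rw [map_mul, map_mul, map_pow, map_pow]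
  exact mul_le_one' (mul_le_one' (ha i) (pow_le_one' hx _)) (pow_le_one' hy _)

theorem map_homEval_mul_sub_le {a b : ℕ → K} (ha : ∀ i, v (a i) ≤ 1) (hb : ∀ i, v (b i) ≤ 1)
    (m : ℕ) {x y x' y' : K} (hx : v x ≤ 1) (hy : v y ≤ 1) (hx' : v x' ≤ 1) (hy' : v y' ≤ 1) :
    v (homEval a m x y * homEval b m x' y' - homEval b m x y * homEval a m x' y') ≤
      v (x * y' - y * x') := by
  obtain ⟨c, hc⟩ := dvd_homEval_mul_sub (R := v.integer) (fun i ↦ ⟨a i, ha i⟩)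
    (fun i ↦ ⟨b i, hb i⟩) m ⟨x, hx⟩ ⟨y, hy⟩ ⟨x', hx'⟩ ⟨y', hy'⟩
  have h := congrArg v.integer.subtype hc
  simp only [map_sub, map_mul, map_homEval, Subring.subtype_apply] at h
  rw [h, map_mul]
  exact mul_le_of_le_one_right' c.2

/-- If both values were in the maximal ideal, the unit resultant would put every monomial of degree
2 m - 1 there, yet x^(2m-1) or y^(2m-1) is a unit. -/
theorem max_map_homEval_eq_one {f g : K[X]} {m : ℕ} (hf : f.natDegree ≤ m) (hg : g.natDegree ≤ m)
    (hint : ∀ i, v (f.coeff i) ≤ 1 ∧ v (g.coeff i) ≤ 1)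
    (hunit : ∃ i, v (f.coeff i) = 1 ∨ v (g.coeff i) = 1) (hres : v (resultant f g m m) = 1)
    {x y : K} (hxy : max (v x) (v y) = 1) :
    max (v (homEval f.coeff m x y)) (v (homEval g.coeff m x y)) = 1 := by
  have hx : v x ≤ 1 := hxy ▸ le_max_left _ _
  have hy : v y ≤ 1 := hxy ▸ le_max_right _ _
  refine le_antisymm (max_le (map_homEval_le_one v (fun i ↦ (hint i).1) m hx hy)
    (map_homEval_le_one v (fun i ↦ (hint i).2) m hx hy)) ?_
  by_contra! hlt
  obtain ⟨hF, hG⟩ := max_lt_iff.1 hlt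
  -- In degree 0 there are no such monomials; the forms are constants and `hunit` decides.
  rcases Nat.eq_zero_or_pos m with rfl | hm
  · obtain ⟨i, hi⟩ := hunit
    rcases Nat.eq_zero_or_pos i with rfl | h0
    · simp only [homEval, zero_add, Finset.range_one, Finset.sum_singleton, pow_zero,
        mul_one, Nat.sub_self] at hF hG
      rcases hi with hi | hi
      exacts [hF.ne hi, hG.ne hi]
    · rw [coeff_eq_zero_of_natDegree_lt (by omega), coeff_eq_zero_of_natDegree_lt (by omega)] at hi
      simp at hi
  · have hTf : (↑f.coeffs : Set K) ⊆ v.integer := by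
      intro c hc
      obtain ⟨i, -, rfl⟩ := mem_coeffs_iff.1 hc
      exact (hint i).1
    have hTg : (↑g.coeffs : Set K) ⊆ v.integer := by
      intro c hc
      obtain ⟨i, -, rfl⟩ := mem_coeffs_iff.1 hc
      exact (hint i).2
    let f' := f.toSubring v.integer hTf
    let g' := g.toSubring v.integer hTg
    have hmf : f'.map v.integer.subtype = f := by ext i; simp [f']
    have hmg : g'.map v.integer.subtype = g := by ext i; simp [g']
    have key : ∀ i < m + m, v (x ^ i * y ^ (2 * m - 1 - i)) < 1 := by
      intro i hi
      obtain ⟨p, q, hpq⟩ := Ideal.mem_span_pair.1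
        (resultant_mul_monomial_mem_span f' g' m (⟨x, hx⟩ : v.integer) ⟨y, hy⟩ hi)
      have h := congrArg v.integer.subtype hpq
      have hf' : (fun i ↦ v.integer.subtype (f'.coeff i)) = f.coeff := by
        rw [← hmf]; ext i; simp
      have hg' : (fun i ↦ v.integer.subtype (g'.coeff i)) = g.coeff := by
        rw [← hmg]; ext i; simp
      rw [map_mul, map_mul, map_pow, map_pow, ← resultant_map_map, hmf, hmg, map_add, map_mul,
        map_mul, map_homEval, map_homEval, hf', hg'] at h
      have h2 := congrArg v h
      rw [map_mul v (resultant f g m m), hres, one_mul] at h2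
      simp only [Subring.subtype_apply] at h2
      rw [← h2]
      refine v.map_add_lt ?_ ?_
      · rw [map_mul]; exact (mul_le_of_le_one_left' p.2).trans_lt hF
      · rw [map_mul]; exact (mul_le_of_le_one_left' q.2).trans_lt hG
    rcases max_choice (v x) (v y) with h | h
    · have := key (2 * m - 1) (by omega)
      rw [Nat.sub_self, pow_zero, mul_one, map_pow, ← h, hxy, one_pow] at this
      exact this.false
    · have := key 0 (by omega)
      rw [Nat.sub_zero, pow_zero, one_mul, map_pow, ← h, hxy, one_pow] at this
      exact this.false

end Valuation

/-! ### Homogeneous coordinates on the projective line -/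

section Wedge

variable {K : Type*} [Field K]

/-- The determinant of two vectors of length two. -/
def wedge (p q : Fin 2 → K) : K := p 0 * q 1 - p 1 * q 0

theorem wedge_self (p : Fin 2 → K) : wedge p p = 0 := by rw [wedge]; ring

theorem wedge_comm (p q : Fin 2 → K) : wedge p q = -wedge q p := by rw [wedge, wedge]; ring

theorem wedge_smul_left (c : K) (p q : Fin 2 → K) : wedge (c • p) q = c * wedge p q := by
  simp only [wedge, Pi.smul_apply, smul_eq_mul]; ring

theorem wedge_smul_right (c : K) (p q : Fin 2 → K) : wedge p (c • q) = c * wedge p q := by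
  simp only [wedge, Pi.smul_apply, smul_eq_mul]; ring

theorem wedge_mulVec (M : Matrix (Fin 2) (Fin 2) K) (p q : Fin 2 → K) :
    wedge (M.mulVec p) (M.mulVec q) = M.det * wedge p q := by
  simp only [wedge, Matrix.mulVec, dotProduct, Fin.sum_univ_two, Matrix.det_fin_two]; ring

theorem exists_eq_smul_of_wedge_eq_zero {p q : Fin 2 → K} (hp : p ≠ 0) (h : wedge p q = 0) :
    ∃ c : K, q = c • p := by
  rw [wedge, sub_eq_zero] at h
  by_cases h0 : p 0 = 0
  · have h1 : p 1 ≠ 0 := fun h1 ↦ hp (by ext i; fin_cases i <;> assumption)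
    refine ⟨q 1 / p 1, ?_⟩
    ext i
    fin_cases i
    · have : q 0 = 0 := by simpa [h0, h1] using h
      simp [h0, this]
    · simp [h1]
  · refine ⟨q 0 / p 0, ?_⟩
    ext i
    fin_cases i
    · simp [h0]
    · simp only [Fin.mk_one, Pi.smul_apply, smul_eq_mul]
      field_simp
      linear_combination h

theorem mulVec_ne_zero {M : Matrix (Fin 2) (Fin 2) K} (hM : M.det ≠ 0) {p : Fin 2 → K}
    (hp : p ≠ 0) : M.mulVec p ≠ 0 := fun h ↦ hp (Matrix.eq_zero_of_mulVec_eq_zero hM h)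

/-- The map on vectors given by two binary forms of degree `m`. -/
def formMap (a b : ℕ → K) (m : ℕ) (p : Fin 2 → K) : Fin 2 → K :=
  ![homEval a m (p 0) (p 1), homEval b m (p 0) (p 1)]

theorem formMap_smul (a b : ℕ → K) (m : ℕ) (c : K) (p : Fin 2 → K) :
    formMap a b m (c • p) = c ^ m • formMap a b m p := by
  ext i
  fin_cases i <;> simp [formMap, homEval_smul]

end Wedge

/-! ### Distances between the points of a cycle at a place of good reduction -/

section Distance

variable {K Γ₀ : Type*} [Field K] [LinearOrderedCommGroupWithZero Γ₀] (v : Valuation K Γ₀)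

/-- The maximum norm of a vector of length two. -/
def vnorm (p : Fin 2 → K) : Γ₀ := max (v (p 0)) (v (p 1))

theorem vnorm_smul (c : K) (p : Fin 2 → K) : vnorm v (c • p) = v c * vnorm v p := by
  simp only [vnorm, Pi.smul_apply, smul_eq_mul, map_mul]
  rcases le_total (v (p 0)) (v (p 1)) with h | h
  · rw [max_eq_right h, max_eq_right (mul_le_mul_right h _)]
  · rw [max_eq_left h, max_eq_left (mul_le_mul_right h _)]

theorem exists_vnorm_smul_eq_one {p : Fin 2 → K} (hp : p ≠ 0) :
    ∃ c : K, c ≠ 0 ∧ vnorm v (c • p) = 1 := by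
  have key : ∀ i, vnorm v p = v (p i) → ∃ c : K, c ≠ 0 ∧ vnorm v (c • p) = 1 := by
    intro i hi
    have h0 : p i ≠ 0 := by
      intro h0
      rw [h0, map_zero] at hi
      have h1 : ∀ j, v (p j) ≤ 0 := by
        intro j
        rw [← hi]
        fin_cases j
        exacts [le_max_left _ _, le_max_right _ _]
      exact hp (funext fun j ↦ (map_eq_zero v).1 (le_antisymm (h1 j) zero_le))
    refine ⟨(p i)⁻¹, inv_ne_zero h0, ?_⟩
    rw [vnorm_smul, hi, ← map_mul, inv_mul_cancel₀ h0, map_one]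
  rcases max_choice (v (p 0)) (v (p 1)) with h | h
  exacts [key 0 h, key 1 h]

theorem exists_unit_smul_of_wedge_eq_zero {p q : Fin 2 → K} (hp : vnorm v p = 1)
    (hq : vnorm v q = 1) (h : wedge p q = 0) : ∃ c : K, v c = 1 ∧ q = c • p := by
  have hp0 : p ≠ 0 := by
    rintro rfl
    simp [vnorm] at hp
  obtain ⟨c, rfl⟩ := exists_eq_smul_of_wedge_eq_zero hp0 h
  rw [vnorm_smul, hp, mul_one] at hq
  exact ⟨c, hq, rfl⟩

/-- The ultrametric inequality follows from the Plücker relation `hid`, read at a coordinate where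
`q` is a unit. -/
theorem map_wedge_le_max {p q r : Fin 2 → K} (hp : vnorm v p = 1) (hq : vnorm v q = 1)
    (hr : vnorm v r = 1) : v (wedge p r) ≤ max (v (wedge p q)) (v (wedge q r)) := by
  have hle : ∀ {p : Fin 2 → K}, vnorm v p = 1 → ∀ i, v (p i) ≤ 1 := by
    intro p hp i
    rw [← hp]
    fin_cases i
    exacts [le_max_left _ _, le_max_right _ _]
  have hid : ∀ i, q i * wedge p r = p i * wedge q r + r i * wedge p q := by
    intro i
    simp only [wedge]
    fin_cases i <;> simp <;> ring
  have key : ∀ i, v (q i) = 1 → v (wedge p r) ≤ max (v (wedge p q)) (v (wedge q r)) := by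
    intro i hi
    have h := congrArg v (hid i)
    rw [map_mul, hi, one_mul] at h
    rw [h, max_comm]
    refine (v.map_add _ _).trans (max_le_max ?_ ?_) <;> rw [map_mul]
    exacts [mul_le_of_le_one_left' (hle hp i), mul_le_of_le_one_left' (hle hr i)]
  rcases max_choice (v (q 0)) (v (q 1)) with h | h
  exacts [key 0 (h ▸ hq), key 1 (h ▸ hq)]

/-- In a cycle of normalized vectors which is moved by a map that does not increase distances, the
distance of two points depends only on the greatest common divisor of the difference of their
indices with the period. -/
theorem map_wedge_eq_of_gcd_eq {q : ℕ → Fin 2 → K} (hq : ∀ i, vnorm v (q i) = 1) {n : ℕ}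
    (hn : 0 < n) (hper : ∀ i, wedge (q i) (q (i + n)) = 0)
    (hstep : ∀ i j, v (wedge (q (i + 1)) (q (j + 1))) ≤ v (wedge (q i) (q j))) (i j : ℕ)
    {l l' : ℕ} (hl : Nat.gcd l n = Nat.gcd l' n) :
    v (wedge (q i) (q (i + l))) = v (wedge (q j) (q (j + l'))) := by
  have hright : ∀ i j, v (wedge (q i) (q (j + n))) = v (wedge (q i) (q j)) := by
    intro i j
    obtain ⟨c, hc, h⟩ := exists_unit_smul_of_wedge_eq_zero v (hq j) (hq (j + n)) (hper j)
    rw [h, wedge_smul_right, map_mul, hc, one_mul]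
  have hleft : ∀ i j, v (wedge (q (i + n)) (q j)) = v (wedge (q i) (q j)) := by
    intro i j
    rw [wedge_comm, Valuation.map_neg, hright, wedge_comm, Valuation.map_neg]
  -- Distances decrease weakly along the orbit and return to their value after n steps, so they are
  -- constant.
  have hshift : ∀ i j, v (wedge (q (i + 1)) (q (j + 1))) = v (wedge (q i) (q j)) := by
    intro i j
    refine le_antisymm (hstep i j) ?_
    have hanti : Antitone fun t ↦ v (wedge (q (i + t)) (q (j + t))) :=
      antitone_nat_of_succ_le fun t ↦ hstep _ _
    have h := hanti (Nat.succ_le_of_lt hn)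
    simp only [hleft, hright] at h
    exact h
  have hzero : ∀ i l, v (wedge (q i) (q (i + l))) = v (wedge (q 0) (q l)) := by
    intro i l
    induction i with
    | zero => rw [zero_add]
    | succ i ih => rw [← ih, ← hshift i (i + l)]; congr 3; ring
  have hadd : ∀ a b, v (wedge (q 0) (q (a + b))) ≤
      max (v (wedge (q 0) (q a))) (v (wedge (q 0) (q b))) := by
    intro a b
    rw [← hzero a b]
    exact map_wedge_le_max v (hq _) (hq _) (hq _)
  have hmul : ∀ a u, v (wedge (q 0) (q (a * u))) ≤ v (wedge (q 0) (q a)) := by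
    intro a u
    induction u with
    | zero => rw [mul_zero, wedge_self, map_zero]; exact zero_le
    | succ u ih => exact (hadd (a * u) a).trans (max_le ih le_rfl)
  have hmod : ∀ a u, v (wedge (q 0) (q (a + n * u))) = v (wedge (q 0) (q a)) := by
    intro a u
    induction u with
    | zero => rfl
    | succ u ih => rw [← ih, ← hright 0 (a + n * u), mul_add, mul_one, add_assoc]
  -- Each of a and gcd(a, n) is a multiple of the other modulo n, and passing to a multiple does not
  -- increase the distance.
  have hgcd : ∀ a, v (wedge (q 0) (q a)) = v (wedge (q 0) (q (Nat.gcd a n))) := by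
    intro a
    apply le_antisymm
    · obtain ⟨u, hu⟩ := Nat.gcd_dvd_left a n
      conv_lhs => rw [hu]
      exact hmul _ u
    · rcases (Nat.le_of_dvd hn (Nat.gcd_dvd_right a n)).eq_or_lt with h | h
      · have h0 := hmod 0 1
        rw [zero_add, mul_one, wedge_self, map_zero] at h0
        rw [h, h0]
        exact zero_le
      · obtain ⟨u, -, hu⟩ := Nat.exists_mul_mod_eq_gcd h
        have h1 := hmod (Nat.gcd a n) (a * u / n)
        rw [← hu, Nat.mod_add_div] at h1
        rw [← hu, ← h1]
        exact hmul a u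
  rw [hzero, hzero, hgcd l, hgcd l', hl]

/-- At a place of good reduction the distances between the points of a cycle are given, up to
weights of the points, by a function of the greatest common divisor of the difference of the
indices with the period. -/
theorem exists_map_wedge_eq {p : ℕ → Fin 2 → K} (hp : ∀ i, p i ≠ 0) {n : ℕ} (hn : 0 < n)
    (hper : ∀ i, wedge (p i) (p (i + n)) = 0) {M : Matrix (Fin 2) (Fin 2) K} (hM : M.det ≠ 0)
    {f g : K[X]} {m : ℕ} (hf : f.natDegree ≤ m) (hg : g.natDegree ≤ m)
    (hint : ∀ i, v (f.coeff i) ≤ 1 ∧ v (g.coeff i) ≤ 1)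
    (hunit : ∃ i, v (f.coeff i) = 1 ∨ v (g.coeff i) = 1) (hres : v (resultant f g m m) = 1)
    (hstep : ∀ i, wedge (formMap f.coeff g.coeff m (M.mulVec (p i))) (M.mulVec (p (i + 1))) = 0) :
    ∃ c δ : ℕ → Γ₀, (∀ i, c i ≠ 0) ∧
      (∀ i l, v (wedge (p i) (p (i + l))) = c i * c (i + l) * δ l) ∧
      ∀ l l', Nat.gcd l n = Nat.gcd l' n → δ l = δ l' := by
  choose μ hμ0 hμ using fun i ↦ exists_vnorm_smul_eq_one v (mulVec_ne_zero hM (hp i))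
  let q : ℕ → Fin 2 → K := fun i ↦ μ i • M.mulVec (p i)
  have hle : ∀ i a, v (q i a) ≤ 1 := by
    intro i a
    rw [← hμ i]
    fin_cases a
    exacts [le_max_left _ _, le_max_right _ _]
  have hwedge : ∀ i j, wedge (q i) (q j) = μ i * μ j * M.det * wedge (p i) (p j) := by
    intro i j
    simp only [q, wedge_smul_left, wedge_smul_right, wedge_mulVec]
    ring
  have hnext : ∀ i, ∃ c : K, v c = 1 ∧ q (i + 1) = c • formMap f.coeff g.coeff m (q i) := by
    intro i
    refine exists_unit_smul_of_wedge_eq_zero v ?_ (hμ (i + 1)) ?_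
    · exact max_map_homEval_eq_one v hf hg hint hunit hres (hμ i)
    · simp only [q, formMap_smul, wedge_smul_left, wedge_smul_right, hstep, mul_zero]
  have key := fun i j l l' ↦ map_wedge_eq_of_gcd_eq v (q := q) hμ hn
    (fun i ↦ by rw [hwedge, hper, mul_zero]) (fun i j ↦ by
      obtain ⟨c, hc, h⟩ := hnext i
      obtain ⟨c', hc', h'⟩ := hnext j
      rw [h, h', wedge_smul_left, wedge_smul_right, map_mul, map_mul, hc, hc', one_mul, one_mul]
      have := map_homEval_mul_sub_le v (fun i ↦ (hint i).1) (fun i ↦ (hint i).2) m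
        (hle i 0) (hle i 1) (hle j 0) (hle j 1)
      exact this) i j (l := l) (l' := l')
  have hv0 : ∀ i, v (μ i) ≠ 0 := fun i ↦ (Valuation.ne_zero_iff v).2 (hμ0 i)
  have hdet : v M.det ≠ 0 := (Valuation.ne_zero_iff v).2 hM
  -- The weights undo the normalization of the vectors; the determinant of the change of coordinates
  -- goes into δ.
  refine ⟨fun i ↦ (v (μ i))⁻¹, fun l ↦ (v M.det)⁻¹ * v (wedge (q 0) (q l)),
    fun i ↦ inv_ne_zero (hv0 i), fun i l ↦ ?_, fun l l' h ↦ ?_⟩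
  · have h1 := key 0 i l l rfl
    rw [zero_add] at h1
    have h2 := hv0 i
    have h3 := hv0 (i + l)
    rw [hwedge i, map_mul, map_mul, map_mul] at h1
    beta_reduce
    rw [h1]
    field_simp
  · have h1 := key 0 0 l l' h
    rw [zero_add, zero_add] at h1
    simp only [h1]

end Distance

/-! ### Homogenizations of polynomials -/

section Homogenization

variable {K : Type*} [Field K]

theorem homEval_coeff_one {f : K[X]} {m : ℕ} (hf : f.natDegree ≤ m) (x : K) :
    homEval f.coeff m x 1 = f.eval x := by
  rw [eval_eq_sum_range' (Nat.lt_succ_of_le hf)]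
  simp [homEval]

theorem homEval_zero_right (a : ℕ → K) (m : ℕ) (x : K) : homEval a m x 0 = a m * x ^ m := by
  rw [homEval, Finset.sum_range_succ, Finset.sum_eq_zero]
  · simp
  · intro i hi
    rw [zero_pow (by have := Finset.mem_range.1 hi; omega), mul_zero]

theorem homEval_coeff_of_ne_zero {f : K[X]} {m : ℕ} (hf : f.natDegree ≤ m) (x : K) {y : K}
    (hy : y ≠ 0) : homEval f.coeff m x y = y ^ m * f.eval (x / y) := by
  rw [← homEval_coeff_one hf, ← homEval_smul, mul_div_cancel₀ _ hy, mul_one]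

theorem homEval_coeff_mul {f g : K[X]} {m n : ℕ} (hf : f.natDegree ≤ m) (hg : g.natDegree ≤ n)
    (x y : K) : homEval (f * g).coeff (m + n) x y =
      homEval f.coeff m x y * homEval g.coeff n x y := by
  by_cases hy : y = 0
  · rw [hy, homEval_zero_right, homEval_zero_right, homEval_zero_right,
      coeff_mul_add_eq_of_natDegree_le hf hg, pow_add]
    ring
  · rw [homEval_coeff_of_ne_zero hf x hy, homEval_coeff_of_ne_zero hg x hy,
      homEval_coeff_of_ne_zero (natDegree_mul_le_of_le hf hg) x hy, eval_mul, pow_add]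
    ring

theorem homEval_coeff_add (f g : K[X]) (m : ℕ) (x y : K) :
    homEval (f + g).coeff m x y = homEval f.coeff m x y + homEval g.coeff m x y := by
  simp [homEval, add_mul, Finset.sum_add_distrib]

theorem homEval_coeff_C_mul (c : K) (f : K[X]) (m : ℕ) (x y : K) :
    homEval (C c * f).coeff m x y = c * homEval f.coeff m x y := by
  simp [homEval, Finset.mul_sum, mul_assoc]

theorem homEval_coeff_sum {ι : Type*} (s : Finset ι) (f : ι → K[X]) (m : ℕ) (x y : K) :
    homEval (∑ i ∈ s, f i).coeff m x y = ∑ i ∈ s, homEval (f i).coeff m x y := by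
  simp only [homEval, finsetSum_coeff, Finset.sum_mul]
  exact Finset.sum_comm

theorem homEval_coeff_pow {f : K[X]} (hf : f.natDegree ≤ 1) (m : ℕ) (x y : K) :
    homEval (f ^ m).coeff m x y = homEval f.coeff 1 x y ^ m := by
  induction m with
  | zero => simp [homEval]
  | succ m ih =>
    rw [pow_succ, pow_succ, ← ih]
    exact homEval_coeff_mul ((natDegree_pow_le).trans (by nlinarith)) hf x y

theorem homEval_linear (a b x y : K) : homEval (C a * X + C b).coeff 1 x y = a * x + b * y := by
  rw [homEval, Finset.sum_range_succ, Finset.sum_range_one]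
  simp only [coeff_add, coeff_C_mul, coeff_X_zero, coeff_C_zero, coeff_X_one, coeff_C_succ]
  ring

/-- The polynomial obtained from the homogenization of `f` in degree `d` by the linear
substitution with matrix `B`. -/
def subst (f : K[X]) (d : ℕ) (B : Matrix (Fin 2) (Fin 2) K) : K[X] :=
  homEval (fun i ↦ C (f.coeff i)) d (C (B 0 0) * X + C (B 0 1)) (C (B 1 0) * X + C (B 1 1))

theorem natDegree_subst_le (f : K[X]) (d : ℕ) (B : Matrix (Fin 2) (Fin 2) K) :
    (subst f d B).natDegree ≤ d := by
  rw [subst, homEval]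
  refine natDegree_sum_le_of_forall_le _ _ fun i hi ↦ ?_
  have hi := Finset.mem_range.1 hi
  have h1 : ((C (B 0 0) * X + C (B 0 1)) ^ i).natDegree ≤ i :=
    natDegree_pow_le.trans ((Nat.mul_le_mul_left i natDegree_linear_le).trans (by omega))
  have h2 : ((C (B 1 0) * X + C (B 1 1)) ^ (d - i)).natDegree ≤ d - i :=
    natDegree_pow_le.trans ((Nat.mul_le_mul_left _ natDegree_linear_le).trans (by omega))
  exact (natDegree_mul_le_of_le ((natDegree_C_mul_le _ _).trans h1) h2).trans (by omega)

theorem homEval_subst (f : K[X]) (d : ℕ) (B : Matrix (Fin 2) (Fin 2) K) (p : Fin 2 → K) :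
    homEval (subst f d B).coeff d (p 0) (p 1) =
      homEval f.coeff d (B.mulVec p 0) (B.mulVec p 1) := by
  have h0 : subst f d B = ∑ i ∈ Finset.range (d + 1), C (f.coeff i) *
      (C (B 0 0) * X + C (B 0 1)) ^ i * (C (B 1 0) * X + C (B 1 1)) ^ (d - i) := rfl
  rw [h0, homEval_coeff_sum, homEval]
  refine Finset.sum_congr rfl fun i hi ↦ ?_
  have hi := Finset.mem_range.1 hi
  rw [mul_assoc, homEval_coeff_C_mul]
  have h1 : ((C (B 0 0) * X + C (B 0 1)) ^ i).natDegree ≤ i :=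
    natDegree_pow_le.trans ((Nat.mul_le_mul_left i natDegree_linear_le).trans (by omega))
  have h2 : ((C (B 1 0) * X + C (B 1 1)) ^ (d - i)).natDegree ≤ d - i :=
    natDegree_pow_le.trans ((Nat.mul_le_mul_left _ natDegree_linear_le).trans (by omega))
  have h3 := homEval_coeff_mul h1 h2 (p 0) (p 1)
  rw [Nat.add_sub_cancel' (by omega), homEval_coeff_pow natDegree_linear_le,
    homEval_coeff_pow natDegree_linear_le, homEval_linear, homEval_linear] at h3
  rw [h3]
  simp only [Matrix.mulVec, dotProduct, Fin.sum_univ_two]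
  ring

theorem algebraMap_subst (f : K[X]) {d : ℕ} (hf : f.natDegree ≤ d)
    (B : Matrix (Fin 2) (Fin 2) K) (hB : C (B 1 0) * X + C (B 1 1) ≠ (0 : K[X])) :
    algebraMap K[X] (RatFunc K) (subst f d B) =
      algebraMap K[X] (RatFunc K) (C (B 1 0) * X + C (B 1 1)) ^ d *
        f.eval₂ RatFunc.C (algebraMap K[X] (RatFunc K) (C (B 0 0) * X + C (B 0 1)) /
          algebraMap K[X] (RatFunc K) (C (B 1 0) * X + C (B 1 1))) := by
  rw [subst, map_homEval, eval₂_eq_sum_range' _ (Nat.lt_succ_of_le hf)]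
  have h0 := RatFunc.algebraMap_ne_zero hB
  conv_lhs => rw [← mul_one (algebraMap K[X] (RatFunc K) (C (B 1 0) * X + C (B 1 1))),
    ← mul_div_cancel₀ (algebraMap K[X] (RatFunc K) (C (B 0 0) * X + C (B 0 1))) h0]
  rw [homEval_smul]
  simp [homEval, RatFunc.algebraMap_C]

end Homogenization

/-! ### The action of a rational function and of its conjugates on vectors -/

section Conjugation

variable {K : Type*} [Field K]

/-- The point of the projective line with given homogeneous coordinates. -/
def toPoint (p : Fin 2 → K) : OnePoint K :=
  open Classical in if p 1 = 0 then none else some (p 0 / p 1)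

theorem toPoint_of_eq_zero {p : Fin 2 → K} (h : p 1 = 0) : toPoint p = none := if_pos h

theorem toPoint_of_ne_zero {p : Fin 2 → K} (h : p 1 ≠ 0) : toPoint p = some (p 0 / p 1) :=
  if_neg h

theorem exists_toPoint_eq (P : OnePoint K) : ∃ p : Fin 2 → K, p ≠ 0 ∧ toPoint p = P := by
  rcases P with _ | x
  · exact ⟨![1, 0], fun h ↦ by simpa using congrFun h 0, toPoint_of_eq_zero rfl⟩
  · refine ⟨![x, 1], fun h ↦ by simpa using congrFun h 1, ?_⟩
    rw [toPoint_of_ne_zero (by simp)]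
    exact congrArg some (div_one x)

theorem toPoint_eq_iff {p q : Fin 2 → K} (hp : p ≠ 0) (hq : q ≠ 0) :
    toPoint p = toPoint q ↔ wedge p q = 0 := by
  have h0 : ∀ {p : Fin 2 → K}, p ≠ 0 → p 1 = 0 → p 0 ≠ 0 := fun hp h1 h ↦
    hp (by ext i; fin_cases i; exacts [h, h1])
  rw [wedge]
  by_cases h1 : p 1 = 0 <;> by_cases h2 : q 1 = 0
  · rw [toPoint_of_eq_zero h1, toPoint_of_eq_zero h2, h1, h2, mul_zero, zero_mul, sub_zero]
    exact iff_of_true rfl rfl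
  · rw [toPoint_of_eq_zero h1, toPoint_of_ne_zero h2, h1, zero_mul, sub_zero]
    exact iff_of_false (Option.some_ne_none _).symm (mul_ne_zero (h0 hp h1) h2)
  · rw [toPoint_of_ne_zero h1, toPoint_of_eq_zero h2, h2, mul_zero, zero_sub]
    exact iff_of_false (Option.some_ne_none _) (neg_ne_zero.2 (mul_ne_zero h1 (h0 hq h2)))
  · rw [toPoint_of_ne_zero h1, toPoint_of_ne_zero h2, sub_eq_zero]
    refine (Option.some_injective K).eq_iff.trans ?_
    rw [div_eq_div_iff h1 h2, mul_comm (q 0)]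

/-- The homogeneous map of degree `ratDegree φ` given by numerator and denominator. -/
def vecMap (φ : RatFunc K) : (Fin 2 → K) → Fin 2 → K :=
  formMap φ.num.coeff φ.denom.coeff (ratDegree φ)

theorem vecMap_ne_zero (φ : RatFunc K) {p : Fin 2 → K} (hp : p ≠ 0) : vecMap φ p ≠ 0 := by
  intro h
  have hn : homEval φ.num.coeff (ratDegree φ) (p 0) (p 1) = 0 := congrFun h 0
  have hd : homEval φ.denom.coeff (ratDegree φ) (p 0) (p 1) = 0 := congrFun h 1
  have hnd : φ.num.natDegree ≤ ratDegree φ := le_max_left _ _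
  have hdd : φ.denom.natDegree ≤ ratDegree φ := le_max_right _ _
  by_cases h1 : p 1 = 0
  · have h0 : p 0 ≠ 0 := fun h0 ↦ hp (by ext i; fin_cases i; exacts [h0, h1])
    rw [h1, homEval_zero_right, mul_eq_zero_iff_right (pow_ne_zero _ h0)] at hn hd
    have hlt : φ.denom.natDegree < ratDegree φ := by
      refine lt_of_le_of_ne hdd fun he ↦ φ.denom_ne_zero ?_
      rwa [← he, coeff_natDegree, leadingCoeff_eq_zero] at hd
    have he : φ.num.natDegree = ratDegree φ := by
      rw [ratDegree] at hlt ⊢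
      omega
    rw [← he, coeff_natDegree, leadingCoeff_eq_zero] at hn
    rw [hn, natDegree_zero] at he
    omega
  · rw [homEval_coeff_of_ne_zero hnd _ h1, mul_eq_zero_iff_left (pow_ne_zero _ h1)] at hn
    rw [homEval_coeff_of_ne_zero hdd _ h1, mul_eq_zero_iff_left (pow_ne_zero _ h1)] at hd
    obtain ⟨a, b, hab⟩ := φ.isCoprime_num_denom
    have := congrArg (eval (p 0 / p 1)) hab
    simp [hn, hd] at this

theorem toMap_toPoint (φ : RatFunc K) {p : Fin 2 → K} (hp : p ≠ 0) :
    toMap φ (toPoint p) = toPoint (vecMap φ p) := by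
  have hnd : φ.num.natDegree ≤ ratDegree φ := le_max_left _ _
  have hdd : φ.denom.natDegree ≤ ratDegree φ := le_max_right _ _
  have hv0 : vecMap φ p 0 = homEval φ.num.coeff (ratDegree φ) (p 0) (p 1) := rfl
  have hv1 : vecMap φ p 1 = homEval φ.denom.coeff (ratDegree φ) (p 0) (p 1) := rfl
  by_cases h1 : p 1 = 0
  · have h0 : p 0 ≠ 0 := fun h0 ↦ hp (by ext i; fin_cases i; exacts [h0, h1])
    have h2 := pow_ne_zero (ratDegree φ) h0
    rw [h1, homEval_zero_right] at hv0 hv1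
    rw [toPoint_of_eq_zero h1]
    by_cases h3 : φ.denom.coeff (ratDegree φ) = 0
    · rw [toPoint_of_eq_zero (by rw [hv1, h3, zero_mul])]
      exact if_pos h3
    · rw [toPoint_of_ne_zero (by rw [hv1]; exact mul_ne_zero h3 h2), hv0, hv1,
        mul_div_mul_right _ _ h2]
      exact if_neg h3
  · have h2 := pow_ne_zero (ratDegree φ) h1
    rw [homEval_coeff_of_ne_zero hnd _ h1] at hv0
    rw [homEval_coeff_of_ne_zero hdd _ h1] at hv1
    rw [toPoint_of_ne_zero h1]
    by_cases h3 : φ.denom.eval (p 0 / p 1) = 0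
    · rw [toPoint_of_eq_zero (by rw [hv1, h3, mul_zero])]
      exact if_pos h3
    · rw [toPoint_of_ne_zero (by rw [hv1]; exact mul_ne_zero h2 h3), hv0, hv1,
        mul_div_mul_left _ _ h2]
      exact if_neg h3

/-- The numerator (for `i = 0`) and the denominator (for `i = 1`) of `conj A φ`, not necessarily
in lowest terms. -/
def conjForm (A : GL (Fin 2) K) (φ : RatFunc K) (i : Fin 2) : K[X] :=
  C (A i 0) * subst φ.num (ratDegree φ) (A⁻¹ : GL (Fin 2) K) +
    C (A i 1) * subst φ.denom (ratDegree φ) (A⁻¹ : GL (Fin 2) K)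

theorem natDegree_conjForm_le (A : GL (Fin 2) K) (φ : RatFunc K) (i : Fin 2) :
    (conjForm A φ i).natDegree ≤ ratDegree φ :=
  natDegree_add_le_of_degree_le ((natDegree_C_mul_le _ _).trans (natDegree_subst_le _ _ _))
    ((natDegree_C_mul_le _ _).trans (natDegree_subst_le _ _ _))

theorem inv_mulVec_mulVec (A : GL (Fin 2) K) (p : Fin 2 → K) :
    (A⁻¹ : GL (Fin 2) K).1.mulVec (A.1.mulVec p) = p := by
  rw [Matrix.mulVec_mulVec, ← Units.val_mul, inv_mul_cancel, Units.val_one, Matrix.one_mulVec]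

theorem formMap_conjForm (A : GL (Fin 2) K) (φ : RatFunc K) (p : Fin 2 → K) :
    formMap (conjForm A φ 0).coeff (conjForm A φ 1).coeff (ratDegree φ) (A.1.mulVec p) =
      A.1.mulVec (vecMap φ p) := by
  have h : ∀ i, homEval (conjForm A φ i).coeff (ratDegree φ) (A.1.mulVec p 0) (A.1.mulVec p 1) =
      A.1.mulVec (vecMap φ p) i := by
    intro i
    rw [conjForm, homEval_coeff_add, homEval_coeff_C_mul, homEval_coeff_C_mul, homEval_subst,
      homEval_subst, inv_mulVec_mulVec]
    simp [Matrix.mulVec, dotProduct, Fin.sum_univ_two, vecMap, formMap]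
  ext i
  fin_cases i
  exacts [h 0, h 1]

theorem subst_inv_ne_zero [Infinite K] (A : GL (Fin 2) K) {f : K[X]} (hf : f ≠ 0) {d : ℕ}
    (hd : f.natDegree ≤ d) : subst f d (A⁻¹ : GL (Fin 2) K) ≠ 0 := by
  intro h
  refine hf (funext fun x ↦ ?_)
  have h1 := homEval_subst f d (A⁻¹ : GL (Fin 2) K).1 (A.1.mulVec ![x, 1])
  rw [h, inv_mulVec_mulVec] at h1
  simp only [Matrix.cons_val_zero, Matrix.cons_val_one, homEval_coeff_one hd] at h1
  rw [← h1]
  simp [homEval]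

theorem conj_eq_div [Infinite K] (A : GL (Fin 2) K) (φ : RatFunc K) :
    conj A φ = algebraMap K[X] (RatFunc K) (conjForm A φ 0) /
      algebraMap K[X] (RatFunc K) (conjForm A φ 1) := by
  have hB : C ((A⁻¹ : GL (Fin 2) K) 1 0) * X + C ((A⁻¹ : GL (Fin 2) K) 1 1) ≠ (0 : K[X]) := by
    intro h
    have h0 : (A⁻¹ : GL (Fin 2) K) 1 0 = 0 := by simpa using congrArg (coeff · 1) h
    have h1 : (A⁻¹ : GL (Fin 2) K) 1 1 = 0 := by simpa using congrArg (coeff · 0) h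
    have hdet : (A⁻¹ : GL (Fin 2) K).1.det ≠ 0 :=
      ((Matrix.isUnit_iff_isUnit_det _).1 (A⁻¹ : GL (Fin 2) K).isUnit).ne_zero
    rw [Matrix.det_fin_two, h0, h1] at hdet
    simp at hdet
  have hn := algebraMap_subst φ.num (d := ratDegree φ) (le_max_left _ _ : φ.num.natDegree ≤ ratDegree φ)
    (A⁻¹ : GL (Fin 2) K).1 hB
  have hd := algebraMap_subst φ.denom (d := ratDegree φ) (le_max_right _ _ : φ.denom.natDegree ≤ ratDegree φ)
    (A⁻¹ : GL (Fin 2) K).1 hB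
  have hd0 : algebraMap K[X] (RatFunc K)
      (subst φ.denom (ratDegree φ) (A⁻¹ : GL (Fin 2) K).1) ≠ 0 :=
    RatFunc.algebraMap_ne_zero (subst_inv_ne_zero A φ.denom_ne_zero (le_max_right _ _))
  have heval : RatFunc.eval (RatFunc.C : K →+* RatFunc K) (postcomp A⁻¹ RatFunc.X) φ =
      algebraMap K[X] (RatFunc K) (subst φ.num (ratDegree φ) (A⁻¹ : GL (Fin 2) K).1) /
        algebraMap K[X] (RatFunc K) (subst φ.denom (ratDegree φ) (A⁻¹ : GL (Fin 2) K).1) := by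
    rw [hn, hd, mul_div_mul_left _ _ (pow_ne_zero _ (RatFunc.algebraMap_ne_zero hB)),
      RatFunc.eval, postcomp]
    simp only [map_add, map_mul, RatFunc.algebraMap_C, RatFunc.algebraMap_X]
  rw [conj, heval, postcomp, conjForm, conjForm]
  simp only [map_add, map_mul, RatFunc.algebraMap_C]
  rw [mul_div_assoc', mul_div_assoc', div_add' _ _ _ hd0, div_add' _ _ _ hd0,
    div_div_div_cancel_right₀ hd0]

end Conjugation

/-! ### Maps with many values at constants are defined over the constants -/

section Constants

variable {k : Type*} [Field k]

/-- A k-linear functional on k(t), applied to the coefficients of U and V, preserves the relations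
U(x) = y V(x) with x, y constant. The cross difference of old and new pairs has degree at most 2 d
and more than 2 d zeros, so it vanishes. -/
theorem exists_eq_div_of_card_lt {U V : (RatFunc k)[X]} {d : ℕ} (hU : U.natDegree ≤ d)
    (hV : V.natDegree ≤ d) (hV0 : V ≠ 0) {ι : Type*} (I : Finset ι) (x y : ι → k)
    (hx : Set.InjOn x I)
    (hxy : ∀ i ∈ I, U.eval (RatFunc.C (x i)) = RatFunc.C (y i) * V.eval (RatFunc.C (x i)))
    (hI : 2 * d < I.card) :
    ∃ u v : k[X], v ≠ 0 ∧
      algebraMap (RatFunc k)[X] (RatFunc (RatFunc k)) U /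
        algebraMap (RatFunc k)[X] (RatFunc (RatFunc k)) V =
      algebraMap (RatFunc k)[X] (RatFunc (RatFunc k)) (u.map RatFunc.C) /
        algebraMap (RatFunc k)[X] (RatFunc (RatFunc k)) (v.map RatFunc.C) := by
  classical
  obtain ⟨j, hj⟩ : ∃ j, V.coeff j ≠ 0 := by
    by_contra! h
    exact hV0 (by ext j; simp [h j])
  -- The functional must not kill V, so that the new denominator is nonzero.
  obtain ⟨ℓ, hℓ⟩ : ∃ ℓ : Module.Dual k (RatFunc k), ℓ (V.coeff j) ≠ 0 := by
    by_contra! h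
    exact hj ((Module.forall_dual_apply_eq_zero_iff k _).1 h)
  let red : (RatFunc k)[X] → k[X] := fun f ↦
    ∑ i ∈ Finset.range (d + 1), monomial i (ℓ (f.coeff i))
  have hred_deg : ∀ f, (red f).natDegree ≤ d := fun f ↦
    natDegree_sum_le_of_forall_le _ _ fun i hi ↦
      (natDegree_monomial_le _).trans (by have := Finset.mem_range.1 hi; omega)
  have hred_eval : ∀ f : (RatFunc k)[X], f.natDegree ≤ d → ∀ a : k,
      (red f).eval a = ℓ (f.eval (RatFunc.C a)) := by
    intro f hf a
    rw [eval_eq_sum_range' (Nat.lt_succ_of_le hf), map_sum, eval_finsetSum]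
    refine Finset.sum_congr rfl fun i _ ↦ ?_
    rw [eval_monomial, ← map_pow, mul_comm (f.coeff i), ← RatFunc.smul_eq_C_mul, map_smul,
      smul_eq_mul, mul_comm]
  have hred_V : red V ≠ 0 := by
    intro h
    apply hℓ
    have h1 := congrArg (coeff · j) h
    simp only [red, finsetSum_coeff, coeff_monomial, coeff_zero] at h1
    rwa [Finset.sum_ite_eq' (Finset.range (d + 1)) j, if_pos] at h1
    exact Finset.mem_range.2 (Nat.lt_succ_of_le ((le_natDegree_of_ne_zero hj).trans hV))
  refine ⟨red U, red V, hred_V, ?_⟩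
  have hinj : Function.Injective (RatFunc.C : k →+* RatFunc k) := RatFunc.C_injective
  rw [div_eq_div_iff (RatFunc.algebraMap_ne_zero hV0)
    (RatFunc.algebraMap_ne_zero ((Polynomial.map_ne_zero_iff hinj).2 hred_V)), ← map_mul,
    ← map_mul, ← sub_eq_zero, ← map_sub]
  suffices h : U * (red V).map RatFunc.C - (red U).map RatFunc.C * V = 0 by rw [h, map_zero]
  refine eq_zero_of_natDegree_lt_card_of_eval_eq_zero' _
    (I.image fun i ↦ RatFunc.C (x i)) ?_ ?_
  · intro z hz
    obtain ⟨i, hi, rfl⟩ := Finset.mem_image.1 hz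
    rw [eval_sub, eval_mul, eval_mul, eval_map_apply, eval_map_apply, hred_eval U hU,
      hred_eval V hV, hxy i hi, ← RatFunc.smul_eq_C_mul, map_smul, smul_eq_mul, map_mul,
      RatFunc.smul_eq_C_mul]
    ring
  · have hc : (I.image fun i ↦ RatFunc.C (x i)).card = I.card :=
      Finset.card_image_of_injOn (hinj.comp_injOn hx)
    rw [hc]
    refine lt_of_le_of_lt ((natDegree_sub_le _ _).trans (max_le ?_ ?_)) hI
    · exact (natDegree_mul_le_of_le hU (natDegree_map_le.trans (hred_deg V))).trans (by omega)
    · exact (natDegree_mul_le_of_le (natDegree_map_le.trans (hred_deg U)) hV).trans (by omega)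

theorem isIsotrivial_of_card_lt [Infinite k] {φ : RatFunc (RatFunc k)} (A : GL (Fin 2) (RatFunc k))
    {p : ℕ → Fin 2 → RatFunc k} (hstep : ∀ i, p (i + 1) = vecMap φ (p i)) (I : Finset ℕ)
    (x y : ℕ → k) (hinj : Set.InjOn x I)
    (hx : ∀ i ∈ I, A.1.mulVec (p i) 1 ≠ 0 ∧
      A.1.mulVec (p i) 0 / A.1.mulVec (p i) 1 = RatFunc.C (x i))
    (hy : ∀ i ∈ I, A.1.mulVec (p (i + 1)) 1 ≠ 0 ∧
      A.1.mulVec (p (i + 1)) 0 / A.1.mulVec (p (i + 1)) 1 = RatFunc.C (y i))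
    (hI : 2 * ratDegree φ < I.card) : IsIsotrivial φ := by
  have : Infinite (RatFunc k) := Infinite.of_injective _ (RatFunc.C_injective (K := k))
  have hform : ∀ i ∈ I, ∀ a, A.1.mulVec (p (i + 1)) a =
      A.1.mulVec (p i) 1 ^ ratDegree φ * (conjForm A φ a).eval (RatFunc.C (x i)) := by
    intro i hi a
    obtain ⟨h1, h2⟩ := hx i hi
    rw [hstep, ← formMap_conjForm, ← h2,
      ← homEval_coeff_of_ne_zero (natDegree_conjForm_le A φ a) _ h1]
    fin_cases a <;> rfl
  have hV : ∀ i ∈ I, (conjForm A φ 1).eval (RatFunc.C (x i)) ≠ 0 := by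
    intro i hi h
    have h1 := hform i hi 1
    rw [h, mul_zero] at h1
    exact (hy i hi).1 h1
  obtain ⟨i₀, hi₀⟩ : I.Nonempty := Finset.card_pos.1 (by omega)
  have hV0 : conjForm A φ 1 ≠ 0 := by
    intro h
    exact hV i₀ hi₀ (by rw [h, eval_zero])
  obtain ⟨u, v, hv, huv⟩ := exists_eq_div_of_card_lt (natDegree_conjForm_le A φ 0)
    (natDegree_conjForm_le A φ 1) hV0 I x y hinj (fun i hi ↦ by
      have h := (hy i hi).2
      rw [hform i hi, hform i hi, mul_div_mul_left _ _ (pow_ne_zero _ (hx i hi).1)] at h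
      rw [← h, div_mul_cancel₀ _ (hV i hi)]) hI
  exact ⟨A, u, v, hv, by rw [conj_eq_div, huv]⟩

end Constants

/-! ### Distances in a cycle at the places of good reduction -/

section GoodReduction

variable {k : Type*} [Field k]

theorem HasGoodReduction.exists_map_wedge_eq [Infinite k] {φ : RatFunc (RatFunc k)}
    {𝔭 : OnePoint k} (h : HasGoodReduction φ 𝔭) {p : ℕ → Fin 2 → RatFunc k}
    (hstep : ∀ i, p (i + 1) = vecMap φ (p i)) (hp : ∀ i, p i ≠ 0) {n : ℕ} (hn : 0 < n)
    (hper : ∀ i, wedge (p i) (p (i + n)) = 0) (h12 : wedge (p 1) (p 2) ≠ 0) :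
    ∃ c δ : ℕ → WithZero (Multiplicative ℤ), (∀ i, c i ≠ 0) ∧
      (∀ i l, placeVal 𝔭 (wedge (p i) (p (i + l))) = c i * c (i + l) * δ l) ∧
      ∀ l l', Nat.gcd l n = Nat.gcd l' n → δ l = δ l' := by
  have : Infinite (RatFunc k) := Infinite.of_injective _ (RatFunc.C_injective (K := k))
  obtain ⟨A, f, g, hg0, hf, hg, hfg, hint, hunit, hres⟩ := h
  have hdet : A.1.det ≠ 0 := ((Matrix.isUnit_iff_isUnit_det _).1 A.isUnit).ne_zero
  have hform : ∀ i a, A.1.mulVec (p (i + 1)) a = homEval (conjForm A φ a).coeff (ratDegree φ)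
      (A.1.mulVec (p i) 0) (A.1.mulVec (p i) 1) := by
    intro i a
    rw [hstep, ← formMap_conjForm]
    fin_cases a <;> rfl
  have hV0 : conjForm A φ 1 ≠ 0 := by
    intro h
    have h1 : ∀ i, A.1.mulVec (p (i + 1)) 1 = 0 := by
      intro i
      rw [hform, h]
      simp [homEval]
    have h2 := wedge_mulVec A.1 (p 1) (p 2)
    rw [wedge, h1 0, h1 1, mul_zero, zero_mul, sub_zero] at h2
    exact mul_ne_zero hdet h12 h2.symm
  have hmul : conjForm A φ 0 * g = f * conjForm A φ 1 := by
    rw [conj_eq_div, div_eq_div_iff (RatFunc.algebraMap_ne_zero hV0)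
      (RatFunc.algebraMap_ne_zero hg0), ← map_mul, ← map_mul] at hfg
    exact RatFunc.algebraMap_injective _ hfg
  refine RatDyn.exists_map_wedge_eq (placeVal 𝔭) hp hn hper hdet hf hg hint hunit hres fun i ↦ ?_
  -- Homogenizing the cross-multiplied identity in the sum of the two degrees avoids comparing the
  -- degree of φ with that of its conjugate.
  have h1 := homEval_coeff_mul (natDegree_conjForm_le A φ 0) hg (A.1.mulVec (p i) 0)
    (A.1.mulVec (p i) 1)
  rw [hmul, add_comm, homEval_coeff_mul hf (natDegree_conjForm_le A φ 1), ← hform, ← hform] at h1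
  simp only [wedge, formMap, Matrix.cons_val_zero, Matrix.cons_val_one]
  rw [h1]
  ring

end GoodReduction

/-! ### The coordinate attached to the first three points of a cycle -/

section Coordinate

variable {K : Type*} [Field K] (p : ℕ → Fin 2 → K)

/-- The value at `p i` of the coordinate sending `p 0, p 1, p 2` to `0, 1, ∞`. -/
def coord (i : ℕ) : K :=
  wedge (p 2) (p 1) * wedge (p 0) (p i) / (wedge (p 0) (p 1) * wedge (p 2) (p i))

/-- The matrix of the coordinate sending `p 0, p 1, p 2` to `0, 1, ∞`. -/
def coordMatrix : Matrix (Fin 2) (Fin 2) K :=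
  !![-(wedge (p 2) (p 1) * p 0 1), wedge (p 2) (p 1) * p 0 0;
    -(wedge (p 0) (p 1) * p 2 1), wedge (p 0) (p 1) * p 2 0]

theorem coordMatrix_mulVec_zero (q : Fin 2 → K) :
    (coordMatrix p).mulVec q 0 = wedge (p 2) (p 1) * wedge (p 0) q := by
  simp [coordMatrix, Matrix.mulVec, dotProduct, Fin.sum_univ_two, wedge]
  ring

theorem coordMatrix_mulVec_one (q : Fin 2 → K) :
    (coordMatrix p).mulVec q 1 = wedge (p 0) (p 1) * wedge (p 2) q := by
  simp [coordMatrix, Matrix.mulVec, dotProduct, Fin.sum_univ_two, wedge]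
  ring

theorem det_coordMatrix :
    (coordMatrix p).det = wedge (p 2) (p 1) * wedge (p 0) (p 1) * wedge (p 0) (p 2) := by
  rw [coordMatrix, Matrix.det_fin_two_of, wedge, wedge, wedge]
  ring

variable {p}

theorem one_sub_coord {i : ℕ} (h01 : wedge (p 0) (p 1) ≠ 0) (hi : wedge (p 2) (p i) ≠ 0) :
    1 - coord p i =
      wedge (p 0) (p 2) * wedge (p 1) (p i) / (wedge (p 0) (p 1) * wedge (p 2) (p i)) := by
  have h := mul_ne_zero h01 hi
  rw [coord, eq_div_iff h, sub_mul, div_mul_cancel₀ _ h]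
  simp only [wedge]
  ring

theorem wedge_eq_zero_of_coord_eq {i j : ℕ} (hdet : (coordMatrix p).det ≠ 0)
    (h01 : wedge (p 0) (p 1) ≠ 0) (hi : wedge (p 2) (p i) ≠ 0) (hj : wedge (p 2) (p j) ≠ 0)
    (h : coord p i = coord p j) : wedge (p i) (p j) = 0 := by
  rw [coord, coord, div_eq_div_iff (mul_ne_zero h01 hi) (mul_ne_zero h01 hj),
    ← coordMatrix_mulVec_zero, ← coordMatrix_mulVec_zero, ← coordMatrix_mulVec_one,
    ← coordMatrix_mulVec_one] at h
  have h1 := wedge_mulVec (coordMatrix p) (p i) (p j)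
  rw [wedge, h] at h1
  refine (mul_eq_zero.1 (h1.symm.trans ?_)).resolve_left hdet
  ring

end Coordinate

/-! ### The bound for the period -/

section Periods

variable {k : Type*} [Field k]

/-- The weight of the moving point cancels in the cross-ratio. What remains involves only fixed
quantities and δ at l, l + 1, l + 2. -/
theorem placeVal_coord_eq {𝔭 : OnePoint k} {p : ℕ → Fin 2 → RatFunc k} {n : ℕ}
    {c δ : ℕ → WithZero (Multiplicative ℤ)} (hc : ∀ i, c i ≠ 0)
    (hδ : ∀ i l, placeVal 𝔭 (wedge (p i) (p (i + l))) = c i * c (i + l) * δ l)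
    (hgcd : ∀ l l', Nat.gcd l n = Nat.gcd l' n → δ l = δ l') {l l' : ℕ}
    (h : ∀ a < 3, Nat.gcd (l + a) n = Nat.gcd (l' + a) n)
    (h01 : wedge (p 0) (p 1) ≠ 0) (hl : wedge (p 2) (p (l + 2)) ≠ 0)
    (hl' : wedge (p 2) (p (l' + 2)) ≠ 0) :
    placeVal 𝔭 (coord p (l + 2)) = placeVal 𝔭 (coord p (l' + 2)) ∧
      placeVal 𝔭 (1 - coord p (l + 2)) = placeVal 𝔭 (1 - coord p (l' + 2)) := by
  have h0 := fun m ↦ hδ 0 (m + 2)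
  have h1 := fun m ↦ hδ 1 (m + 1)
  have h2 := fun m ↦ hδ 2 m
  simp only [zero_add, show ∀ m, 1 + (m + 1) = m + 2 by intro m; omega,
    show ∀ m, 2 + m = m + 2 by intro m; omega] at h0 h1 h2
  have hcancel : ∀ x y u w e e' : WithZero (Multiplicative ℤ), ∀ m,
      x * (u * c (m + 2) * e) / (y * (w * c (m + 2) * e')) = x * u * e / (y * w * e') := by
    intro x y u w e e' m
    rw [show x * (u * c (m + 2) * e) = x * u * e * c (m + 2) by ac_rfl,
      show y * (w * c (m + 2) * e') = y * w * e' * c (m + 2) by ac_rfl,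
      mul_div_mul_right _ _ (hc _)]
  constructor
  · rw [coord, coord]
    simp only [map_div₀, map_mul, h0, h2, hcancel, hgcd _ _ (h 2 (by norm_num))]
    rw [hgcd l l' (h 0 (by norm_num))]
  · rw [one_sub_coord h01 hl, one_sub_coord h01 hl']
    simp only [map_div₀, map_mul, h1, h2, hcancel, hgcd _ _ (h 1 (by norm_num))]
    rw [hgcd l l' (h 0 (by norm_num))]

/-- The equations z = a w and 1 - z = b (1 - w) determine w over k unless a = b, and then a = b = 1
and z = w. -/
theorem mem_range_C_of_div_mem_range_C {z w : RatFunc k} (hzw : z ≠ w) (hw0 : w ≠ 0)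
    (hw1 : 1 - w ≠ 0) (h0 : z / w ∈ Set.range (RatFunc.C : k →+* RatFunc k))
    (h1 : (1 - z) / (1 - w) ∈ Set.range (RatFunc.C : k →+* RatFunc k)) :
    w ∈ Set.range (RatFunc.C : k →+* RatFunc k) := by
  obtain ⟨a, ha⟩ := h0
  obtain ⟨b, hb⟩ := h1
  rw [eq_div_iff hw0] at ha
  rw [eq_div_iff hw1] at hb
  have hba : b - a ≠ 0 := by
    intro hba
    obtain rfl : b = a := sub_eq_zero.1 hba
    have h : RatFunc.C b = (1 : RatFunc k) := by linear_combination hb + ha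
    rw [h, one_mul] at ha
    exact hzw ha.symm
  refine ⟨(b - 1) / (b - a), ?_⟩
  have hC : (RatFunc.C (b - a) : RatFunc k) ≠ 0 := by
    rwa [Ne, map_eq_zero]
  rw [map_div₀, div_eq_iff hC, map_sub, map_sub, map_one]
  linear_combination hb + ha

/-- `p` is a sequence of vectors in `k(t)²` representing a cycle of exact length `n ≥ 5` of `φ`. -/
structure IsVecCycle (φ : RatFunc (RatFunc k)) (p : ℕ → Fin 2 → RatFunc k) (n : ℕ) : Prop where
  step : ∀ i, p (i + 1) = vecMap φ (p i)
  ne_zero : ∀ i, p i ≠ 0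
  wedge_eq_zero_iff : ∀ i j, wedge (p i) (p j) = 0 ↔ i ≡ j [MOD n]
  five_le : 5 ≤ n

theorem exists_isVecCycle {φ : RatFunc (RatFunc k)} {P : OnePoint (RatFunc k)}
    (hn : 5 ≤ Function.minimalPeriod (toMap φ) P) :
    ∃ p, IsVecCycle φ p (Function.minimalPeriod (toMap φ) P) := by
  obtain ⟨q, hq, rfl⟩ := exists_toPoint_eq P
  let p : ℕ → Fin 2 → RatFunc k := fun i ↦ (vecMap φ)^[i] q
  have hstep : ∀ i, p (i + 1) = vecMap φ (p i) := fun i ↦ Function.iterate_succ_apply' _ _ _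
  have hne : ∀ i, p i ≠ 0 := by
    intro i
    induction i with
    | zero => exact hq
    | succ i ih => rw [hstep]; exact vecMap_ne_zero φ ih
  have hpt : ∀ i, toPoint (p i) = (toMap φ)^[i] (toPoint q) := by
    intro i
    induction i with
    | zero => rfl
    | succ i ih => rw [Function.iterate_succ_apply', ← ih, hstep, toMap_toPoint φ (hne i)]
  refine ⟨p, hstep, hne, fun i j ↦ ?_, hn⟩
  rw [← toPoint_eq_iff (hne i) (hne j), hpt, hpt, Nat.ModEq,
    ← Function.iterate_mod_minimalPeriod_eq (n := i),
    ← Function.iterate_mod_minimalPeriod_eq (n := j)]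
  exact Function.iterate_eq_iterate_iff_of_lt_minimalPeriod (Nat.mod_lt _ (by omega))
    (Nat.mod_lt _ (by omega))

/-! ### Coordinates of the points of a cycle -/

namespace IsVecCycle

variable {φ : RatFunc (RatFunc k)} {p : ℕ → Fin 2 → RatFunc k} {n : ℕ}

theorem wedge_ne_zero (h : IsVecCycle φ p n) {i l : ℕ} (hl : Nat.gcd l n < n) :
    wedge (p i) (p (i + l)) ≠ 0 := by
  rw [Ne, h.wedge_eq_zero_iff]
  intro hmod
  have h1 : 0 ≡ l [MOD n] := Nat.ModEq.add_left_cancel' i hmod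
  have h2 := h1.symm.gcd_eq
  rw [Nat.gcd_zero_left] at h2
  omega

theorem gcd_lt (h : IsVecCycle φ p n) {l a : ℕ} (hl : l ∈ goodResidues n) (ha : a < 4) :
    Nat.gcd (l + a) n < n := by
  rw [(mem_goodResidues.1 hl).2 a ha]
  have h1 := Nat.gcd_le_left n (show 0 < 1 + a by omega)
  have h2 := h.five_le
  omega

theorem gcd_lt' (h : IsVecCycle φ p n) {l : ℕ} (h0 : 0 < l) (hl : l < 5) : Nat.gcd l n < n :=
  (Nat.gcd_le_left n h0).trans_lt (hl.trans_le h.five_le)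

theorem wedge_zero_one (h : IsVecCycle φ p n) : wedge (p 0) (p 1) ≠ 0 :=
  h.wedge_ne_zero (i := 0) (l := 1) (h.gcd_lt' (by norm_num) (by norm_num))

theorem wedge_zero_two (h : IsVecCycle φ p n) : wedge (p 0) (p 2) ≠ 0 :=
  h.wedge_ne_zero (i := 0) (l := 2) (h.gcd_lt' (by norm_num) (by norm_num))

theorem wedge_one_two (h : IsVecCycle φ p n) : wedge (p 1) (p 2) ≠ 0 :=
  h.wedge_ne_zero (i := 1) (l := 1) (h.gcd_lt' (by norm_num) (by norm_num))

theorem wedge_two_one (h : IsVecCycle φ p n) : wedge (p 2) (p 1) ≠ 0 := by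
  rw [wedge_comm]
  exact neg_ne_zero.2 h.wedge_one_two

theorem wedge_two_zero (h : IsVecCycle φ p n) : wedge (p 2) (p 0) ≠ 0 := by
  rw [wedge_comm]
  exact neg_ne_zero.2 h.wedge_zero_two

theorem det_coordMatrix_ne_zero (h : IsVecCycle φ p n) : (coordMatrix p).det ≠ 0 := by
  rw [det_coordMatrix]
  exact mul_ne_zero (mul_ne_zero h.wedge_two_one h.wedge_zero_one) h.wedge_zero_two

theorem wedge_two_ne_zero (h : IsVecCycle φ p n) {l a : ℕ} (hl : l ∈ goodResidues n)
    (ha : a < 2) : wedge (p 2) (p (l + a + 2)) ≠ 0 := by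
  rw [add_comm _ 2]
  exact h.wedge_ne_zero (h.gcd_lt hl (by omega))

theorem coord_ne_zero (h : IsVecCycle φ p n) {l a : ℕ} (hl : l ∈ goodResidues n) (ha : a < 2) :
    coord p (l + a + 2) ≠ 0 := by
  have h1 := h.wedge_ne_zero (i := 0) (h.gcd_lt hl (a := a + 2) (by omega))
  rw [zero_add, ← add_assoc] at h1
  exact div_ne_zero (mul_ne_zero h.wedge_two_one h1)
    (mul_ne_zero h.wedge_zero_one (h.wedge_two_ne_zero hl ha))

theorem one_sub_coord_ne_zero (h : IsVecCycle φ p n) {l a : ℕ} (hl : l ∈ goodResidues n)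
    (ha : a < 2) : 1 - coord p (l + a + 2) ≠ 0 := by
  have h1 := h.wedge_ne_zero (i := 1) (h.gcd_lt hl (a := a + 1) (by omega))
  rw [show 1 + (l + (a + 1)) = l + a + 2 by ring] at h1
  rw [one_sub_coord h.wedge_zero_one (h.wedge_two_ne_zero hl ha)]
  exact div_ne_zero (mul_ne_zero h.wedge_zero_two h1)
    (mul_ne_zero h.wedge_zero_one (h.wedge_two_ne_zero hl ha))

theorem injOn_coord (h : IsVecCycle φ p n) {a : ℕ} (ha : a < 2) :
    Set.InjOn (fun l ↦ coord p (l + a + 2)) (goodResidues n) := by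
  intro l hl l' hl' he
  have h1 := wedge_eq_zero_of_coord_eq h.det_coordMatrix_ne_zero h.wedge_zero_one
    (h.wedge_two_ne_zero hl ha) (h.wedge_two_ne_zero hl' ha) he
  rw [h.wedge_eq_zero_iff] at h1
  have h2 := (Nat.ModEq.add_right_cancel' _ h1).add_right_cancel' a
  exact h2.eq_of_lt_of_lt (mem_goodResidues.1 hl).1 (mem_goodResidues.1 hl').1

theorem placeVal_coord_eq [Infinite k] (h : IsVecCycle φ p n) {𝔭 : OnePoint k}
    (h𝔭 : HasGoodReduction φ 𝔭) {l l' a : ℕ} (hl : l ∈ goodResidues n)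
    (hl' : l' ∈ goodResidues n) (ha : a < 2) :
    placeVal 𝔭 (coord p (l + a + 2)) = placeVal 𝔭 (coord p (l' + a + 2)) ∧
      placeVal 𝔭 (1 - coord p (l + a + 2)) = placeVal 𝔭 (1 - coord p (l' + a + 2)) := by
  have hn : 0 < n := by have := h.five_le; omega
  obtain ⟨c, δ, hc, hδ, hgcd⟩ := h𝔭.exists_map_wedge_eq h.step h.ne_zero hn
    (fun i ↦ (h.wedge_eq_zero_iff _ _).2 (by simp [Nat.ModEq])) h.wedge_one_two
  refine RatDyn.placeVal_coord_eq hc hδ hgcd (fun b hb ↦ ?_) h.wedge_zero_one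
    (h.wedge_two_ne_zero hl ha) (h.wedge_two_ne_zero hl' ha)
  rw [add_assoc, add_assoc, (mem_goodResidues.1 hl).2 _ (by omega),
    (mem_goodResidues.1 hl').2 _ (by omega)]

theorem card_filter_notMem_le [IsAlgClosed k] [CharZero k] (h : IsVecCycle φ p n)
    {S : Finset (OnePoint k)} (hS : 2 ≤ S.card) (hgood : ∀ 𝔭 ∉ S, HasGoodReduction φ 𝔭)
    {a : ℕ} (ha : a < 2) [DecidablePred fun l ↦
      coord p (l + a + 2) ∉ Set.range (RatFunc.C : k →+* RatFunc k)] :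
    ((goodResidues n).filter fun l ↦
      coord p (l + a + 2) ∉ Set.range (RatFunc.C : k →+* RatFunc k)).card ≤
      6 * 384 ^ S.card := by
  classical
  rw [← Finset.card_image_of_injOn ((h.injOn_coord ha).mono (Finset.filter_subset _ _))]
  refine card_le_of_placeVal_eq S hS _ ?_ ?_
  · intro z hz
    obtain ⟨l, hl, rfl⟩ := Finset.mem_image.1 hz
    exact (Finset.mem_filter.1 hl).2
  · intro z hz w hw 𝔭 h𝔭
    obtain ⟨l, hl, rfl⟩ := Finset.mem_image.1 hz
    obtain ⟨l', hl', rfl⟩ := Finset.mem_image.1 hw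
    exact h.placeVal_coord_eq (hgood 𝔭 h𝔭) (Finset.mem_filter.1 hl).1
      (Finset.mem_filter.1 hl').1 ha

/-- For a second good residue, the quotients of the coordinates and of their complements to 1 are
units at all places but one, hence constant. -/
theorem coord_mem_range_C [IsAlgClosed k] [CharZero k] (h : IsVecCycle φ p n)
    {S : Finset (OnePoint k)} (hS : S.card = 1) (hgood : ∀ 𝔭 ∉ S, HasGoodReduction φ 𝔭)
    (hJ : 1 < (goodResidues n).card) {l a : ℕ} (hl : l ∈ goodResidues n) (ha : a < 2) :
    coord p (l + a + 2) ∈ Set.range (RatFunc.C : k →+* RatFunc k) := by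
  obtain ⟨𝔮, rfl⟩ := Finset.card_eq_one.1 hS
  obtain ⟨l', hl', hne⟩ := Finset.exists_mem_ne hJ l
  have hz0 := h.coord_ne_zero hl ha
  have hz1 := h.one_sub_coord_ne_zero hl ha
  have hw0 := h.coord_ne_zero hl' ha
  have hw1 := h.one_sub_coord_ne_zero hl' ha
  refine mem_range_C_of_div_mem_range_C (z := coord p (l' + a + 2))
    (fun he ↦ hne (h.injOn_coord ha hl' hl he)) hz0 hz1 ?_ ?_
  · refine mem_range_C_of_placeVal_eq_one (div_ne_zero hw0 hz0) 𝔮 fun 𝔭 h𝔭 ↦ ?_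
    rw [map_div₀, (h.placeVal_coord_eq (hgood 𝔭 (by simpa using h𝔭)) hl' hl ha).1]
    exact div_self ((Valuation.ne_zero_iff _).2 hz0)
  · refine mem_range_C_of_placeVal_eq_one (div_ne_zero hw1 hz1) 𝔮 fun 𝔭 h𝔭 ↦ ?_
    rw [map_div₀, (h.placeVal_coord_eq (hgood 𝔭 (by simpa using h𝔭)) hl' hl ha).2]
    exact div_self ((Valuation.ne_zero_iff _).2 hz1)

/-- Few points of the cycle of a map which is not isotrivial have, together with their images,
constant coordinates. -/
theorem card_add_one_le [Infinite k] (h : IsVecCycle φ p n) (hφ : ¬ IsIsotrivial φ)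
    (G : Finset ℕ) (hG : G ⊆ goodResidues n)
    (hconst : ∀ l ∈ G, ∀ a < 2,
      coord p (l + a + 2) ∈ Set.range (RatFunc.C : k →+* RatFunc k)) :
    G.card + 1 ≤ 2 * ratDegree φ := by
  classical
  by_contra! hlt
  let A := Matrix.GeneralLinearGroup.mkOfDetNeZero (coordMatrix p) h.det_coordMatrix_ne_zero
  have hA : ∀ i, wedge (p 2) (p i) ≠ 0 →
      A.1.mulVec (p i) 1 ≠ 0 ∧ A.1.mulVec (p i) 0 / A.1.mulVec (p i) 1 = coord p i := by
    intro i hi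
    have h0 : A.1.mulVec (p i) 0 = _ := coordMatrix_mulVec_zero p (p i)
    have h1 : A.1.mulVec (p i) 1 = _ := coordMatrix_mulVec_one p (p i)
    rw [h0, h1]
    exact ⟨mul_ne_zero h.wedge_zero_one hi, rfl⟩
  -- The index 0 is a free extra point: `p 0` and its image `p 1` have coordinates 0 and 1.
  let I : Finset ℕ := insert 0 (G.image (· + 2))
  have hIcard : I.card = G.card + 1 := by
    rw [Finset.card_insert_of_notMem (by simp),
      Finset.card_image_of_injective _ (add_left_injective 2)]
  have hI : ∀ i ∈ I, (wedge (p 2) (p i) ≠ 0 ∧ wedge (p 2) (p (i + 1)) ≠ 0) ∧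
      coord p i ∈ Set.range (RatFunc.C : k →+* RatFunc k) ∧
      coord p (i + 1) ∈ Set.range (RatFunc.C : k →+* RatFunc k) := by
    intro i hi
    rcases Finset.mem_insert.1 hi with rfl | hi
    · refine ⟨⟨h.wedge_two_zero, h.wedge_two_one⟩, ⟨0, ?_⟩, ⟨1, ?_⟩⟩
      · rw [coord, wedge_self, mul_zero, zero_div, map_zero]
      · rw [coord, zero_add, mul_comm, map_one]
        exact (div_self (mul_ne_zero h.wedge_zero_one h.wedge_two_one)).symm
    · obtain ⟨l, hl, rfl⟩ := Finset.mem_image.1 hi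
      have e : l + 2 + 1 = l + 1 + 2 := by ring
      simp only [e]
      exact ⟨⟨h.wedge_two_ne_zero (hG hl) (a := 0) (by norm_num),
        h.wedge_two_ne_zero (hG hl) (a := 1) (by norm_num)⟩,
        hconst l hl 0 (by norm_num), hconst l hl 1 (by norm_num)⟩
  have hmod : ∀ i ∈ I, ∀ j ∈ I, i ≡ j [MOD n] → i = j := by
    have h0 : ∀ l ∈ G, ¬ 0 ≡ l + 2 [MOD n] := by
      intro l hl hc
      have h1 := h.wedge_ne_zero (i := 0) (h.gcd_lt (hG hl) (a := 2) (by norm_num))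
      rw [Ne, h.wedge_eq_zero_iff, zero_add] at h1
      exact h1 hc
    intro i hi j hj hij
    rcases Finset.mem_insert.1 hi with rfl | hi <;> rcases Finset.mem_insert.1 hj with rfl | hj
    · rfl
    · obtain ⟨l, hl, rfl⟩ := Finset.mem_image.1 hj
      exact absurd hij (h0 l hl)
    · obtain ⟨l, hl, rfl⟩ := Finset.mem_image.1 hi
      exact absurd hij.symm (h0 l hl)
    · obtain ⟨l, hl, rfl⟩ := Finset.mem_image.1 hi
      obtain ⟨l', hl', rfl⟩ := Finset.mem_image.1 hj
      rw [(hij.add_right_cancel' 2).eq_of_lt_of_lt (mem_goodResidues.1 (hG hl)).1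
        (mem_goodResidues.1 (hG hl')).1]
  choose! x hx using fun i hi ↦ (hI i hi).2.1
  choose! y hy using fun i hi ↦ (hI i hi).2.2
  refine hφ (isIsotrivial_of_card_lt A h.step I x y ?_ ?_ ?_ (by omega))
  · intro i hi j hj hij
    refine hmod i hi j hj ((h.wedge_eq_zero_iff i j).1 ?_)
    refine wedge_eq_zero_of_coord_eq h.det_coordMatrix_ne_zero h.wedge_zero_one
      (hI i hi).1.1 (hI j hj).1.1 ?_
    rw [← hx i hi, ← hx j hj, hij]
  · intro i hi
    rw [hx i hi]
    exact hA i (hI i hi).1.1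
  · intro i hi
    rw [hy i hi]
    exact hA (i + 1) (hI i hi).1.2

theorem le_periodBound [IsAlgClosed k] [CharZero k] (h : IsVecCycle φ p n)
    (hφ : ¬ IsIsotrivial φ) {S : Finset (OnePoint k)} (hS : 1 ≤ S.card)
    (hgood : ∀ 𝔭 ∉ S, HasGoodReduction φ 𝔭) : n ≤ periodBound (ratDegree φ) S.card := by
  classical
  have hn := le_card_goodResidues_sq (n := n) (by have := h.five_le; omega)
  -- The empty set already gives 1 ≤ 2 d, so the degree is positive.
  have hd := h.card_add_one_le hφ ∅ (Finset.empty_subset _) (by simp)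
  rw [Finset.card_empty] at hd
  rcases hS.eq_or_lt with hS | hS
  · have hJ : (goodResidues n).card ≤ 2 * ratDegree φ - 1 := by
      rcases Nat.lt_or_ge 1 (goodResidues n).card with hJ | hJ
      · have := h.card_add_one_le hφ _ subset_rfl fun l hl a ha ↦
          h.coord_mem_range_C hS.symm hgood hJ hl ha
        omega
      · omega
    rw [← hS]
    exact hn.trans ((Nat.mul_le_mul_left _ (Nat.pow_le_pow_left hJ 2)).trans le_periodBound_one)
  · let R := Set.range (RatFunc.C : k →+* RatFunc k)
    -- A good residue is in G, or the coordinate of its point or of that point's image is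
    -- nonconstant; the last two sets are bounded by the unit-equation count.
    let G := (goodResidues n).filter fun l ↦ coord p (l + 0 + 2) ∈ R ∧ coord p (l + 1 + 2) ∈ R
    let B : ℕ → Finset ℕ := fun a ↦ (goodResidues n).filter fun l ↦ coord p (l + a + 2) ∉ R
    have hG := h.card_add_one_le hφ G (Finset.filter_subset _ _) fun l hl a ha ↦ by
      have h1 := (Finset.mem_filter.1 hl).2
      interval_cases a
      exacts [h1.1, h1.2]
    have h0 : (B 0).card ≤ 6 * 384 ^ S.card :=
      h.card_filter_notMem_le hS hgood (a := 0) (by norm_num)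
    have h1 : (B 1).card ≤ 6 * 384 ^ S.card :=
      h.card_filter_notMem_le hS hgood (a := 1) (by norm_num)
    have hsub : goodResidues n ⊆ G ∪ B 0 ∪ B 1 := by
      intro l hl
      simp only [Finset.mem_union, Finset.mem_filter, G, B, hl, true_and]
      tauto
    have h2 := (Finset.card_le_card hsub).trans ((Finset.card_union_le _ _).trans
      (Nat.add_le_add_right (Finset.card_union_le _ _) _))
    have hJ : (goodResidues n).card ≤ 2 * (6 * 384 ^ S.card) + (2 * ratDegree φ - 1) := by
      omega
    exact hn.trans ((Nat.mul_le_mul_left _ (Nat.pow_le_pow_left hJ 2)).trans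
      (RatDyn.le_periodBound (by omega) hS))

end IsVecCycle

theorem four_le_periodBound (d : ℕ) {s : ℕ} (hs : 1 ≤ s) : 4 ≤ periodBound d s := by
  have h := prod_le_periodBound (d := d) (s := s) {2} (fun _ ↦ 4)
    (by intro p hp; rw [Finset.mem_singleton.1 hp]; exact ⟨Nat.prime_two, by simp [primeBound]⟩)
    (by
      intro p hp
      rw [Finset.mem_singleton.1 hp]
      refine le_max_of_le_right ?_
      have : 3 ^ 1 ≤ 3 ^ (2 * s - 1) := Nat.pow_le_pow_right (by norm_num) (by omega)
      omega)
  simpa using h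

end Periods

end RatDyn

end

/-! ### The main theorem -/

theorem theorem1p2 {k : Type*} [Field k] [IsAlgClosed k] [CharZero k]
    (S : Finset (OnePoint k)) (s : ℕ) (hS : S.card = s) (hs : 1 ≤ s)
    (d : ℕ) (φ : RatFunc (RatFunc k)) (hd : RatDyn.ratDegree φ = d)
    (hiso : ¬ RatDyn.IsIsotrivial φ)
    (hgood : ∀ 𝔭 : OnePoint k, 𝔭 ∉ S → RatDyn.HasGoodReduction φ 𝔭)
    (P : OnePoint (RatFunc k)) (n : ℕ)
    (hP : P ∈ Function.periodicPts (RatDyn.toMap φ))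
    (hn : Function.minimalPeriod (RatDyn.toMap φ) P = n) :
    n ≤ RatDyn.periodBound d s := by
  subst hS hd hn
  rcases Nat.lt_or_ge (Function.minimalPeriod (RatDyn.toMap φ) P) 5 with h | h
  · exact (Nat.le_of_lt_succ h).trans (RatDyn.four_le_periodBound _ hs)
  · obtain ⟨p, hp⟩ := RatDyn.exists_isVecCycle h
    exact hp.le_periodBound hiso hs hgood
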